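/- Let $\Omega\subset\mathbb{C}^n$ be a bounded pseudoconvex domain (i.e. $\Omega$ admits a smooth strictly plurisubharmonic exhaustion function) with $C^2$ boundary $b\Omega$. Let $\delta(z)=\mathrm{dist}(z,b\Omega)$, let $\tilde\delta$ be the signed distance function ($\tilde\delta=-\delta$ in $\Omega$ and $\tilde\delta=\delta$ outside $\Omega$), which is $C^2$ near $b\Omega$, and let $r=\sup_{z\in\Omega}|z|$. For a $(1,0)$-vector $\tau=\sum_k\tau_k\,\partial/\partial z_k$ let $|\tau|$ be its length in the metric with Kähler form $\frac i2\partial\bar\partial|z|^2$, i.e. $|\tau|^2=\frac12\sum_k|\tau_k|^2$. Let $\alpha_\Omega$ be the real one-form $$\alpha_\Omega=4\sum_{j=1}^n\mathrm{Re}\left(\frac{\partial\tilde\delta}{\partial\bar z_j}\,\bar\partial\Big(\frac{\partial\tilde\delta}{\partial z_j}\Big)\right),$$ extended complex-linearly to complex vectors, so that $\alpha_\Omega(\tau)=2\sum_{j,k}\frac{\partial\tilde\delta}{\partial z_j}\frac{\partial^2\tilde\delta}{\partial\bar z_j\partial z_k}\tau_k$ for a $(1,0)$-vector $\tau$. For $p\in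 b\Omega$ let $T^{1,0}_p(b\Omega)$ be the space of $(1,0)$-vectors $\tau$ with $\sum_j\frac{\partial\tilde\delta}{\partial z_j}(p)\,\tau_j=0$, and let $$\mathcal N_p(\Omega)=\Big\{\tau\in T^{1,0}_p(b\Omega):\ \sum_{j,k}\frac{\partial^2\tilde\delta}{\partial z_j\partial\bar z_k}(p)\,\tau_j\bar\theta_k=0\ \text{ for all }\theta\in T^{1,0}_p(b\Omega)\Big\}.$$ Put $$A=\sup\Big\{\frac{|\alpha_\Omega(\tau)|}{|\tau|}:\ p\in b\Omega,\ \tau\in\mathcal N_p(\Omega)\setminus\{0\}\Big\},$$ with $A=0$ if there is no such $\tau$, i.e. if $\Omega$ is strictly pseudoconvex. Let $DF_{C^2}(\Omega)$ be the supremum of all $\eta\in(0,1)$ for which there are a constant $c>1$ and a function $\rho\in C^2(\overline\Omega)$ (the restriction of a $C^2$ function on a neighborhood of $\overline\Omega$) such that $-c\,\delta\le\rho\le-\delta$ on $\overline\Omega$ and $-(-\rho)^\eta$ is plurisubharmonic on $\Omega$ ($DF_{C^2}(\Omega)=0$ if there is no such $\eta$). Then $A<\infty$ and $$DF_{C^2}(\Omega)\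 \ge\ \frac{1}{1+4\sqrt2\,A\,r}.$$ -/

import Mathlib

open scoped ContDiff

noncomputable section

namespace DFIndex

/-- `ℂⁿ` with its Euclidean norm. -/
abbrev Cn (n : ℕ) : Type := EuclideanSpace ℂ (Fin n)

variable {n : ℕ}

/-! ### Wirtinger calculus -/

/-- `∂f/∂z_j = (1/2) (∂f/∂x_j - i ∂f/∂y_j)`. -/
def dz (j : Fin n) (f : Cn n → ℂ) (z : Cn n) : ℂ :=
  (1 / 2) * (fderiv ℝ f z (EuclideanSpace.single j 1)
    - Complex.I * fderiv ℝ f z (EuclideanSpace.single j Complex.I))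

/-- `∂f/∂z̄_j = (1/2) (∂f/∂x_j + i ∂f/∂y_j)`. -/
def dzbar (j : Fin n) (f : Cn n → ℂ) (z : Cn n) : ℂ :=
  (1 / 2) * (fderiv ℝ f z (EuclideanSpace.single j 1)
    + Complex.I * fderiv ℝ f z (EuclideanSpace.single j Complex.I))

/-! A vector `v : Cn n` is used both as a real tangent vector and as the coefficient vector of
the `(1,0)`-vector `τ = ∑ v_k ∂/∂z_k = (1/2) (v - i J v)`. -/

/-- `∂u(τ) = ∑_j ∂u/∂z_j τ_j` for a real function `u` and a `(1,0)`-vector `τ`. -/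
def del (u : Cn n → ℝ) (z : Cn n) (τ : Cn n) : ℂ :=
  ∑ j, dz j (fun w => (u w : ℂ)) z * τ j

/-- The complex Hessian `i∂∂̄u(τ, θ̄) = ∑_{j,k} ∂²u/∂z_j∂z̄_k τ_j θ̄_k`. -/
def levi (u : Cn n → ℝ) (z : Cn n) (τ θ : Cn n) : ℂ :=
  ∑ j, ∑ k, dz j (dzbar k (fun w => (u w : ℂ))) z * τ j * (starRingEnd ℂ) (θ k)

/-- The length of the `(1,0)`-vector `τ = ∑ τ_k ∂/∂z_k` for the Hermitian metric given by the
Kähler form `ω = (i/2) ∂∂̄|z|²`, for which `|∂/∂z_k|² = 1/2`. -/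
def vecNorm (τ : Cn n) : ℝ := ‖τ‖ / Real.sqrt 2

/-- `u` is a plurisubharmonic function of class `C²` on the open set `Ω`. -/
def IsPSH (u : Cn n → ℝ) (Ω : Set (Cn n)) : Prop :=
  ContDiffOn ℝ 2 u Ω ∧ ∀ z ∈ Ω, ∀ τ : Cn n, 0 ≤ (levi u z τ τ).re

/-- `u` is a smooth strictly plurisubharmonic function on the open set `Ω`. -/
def IsSmoothStrictlyPSH (u : Cn n → ℝ) (Ω : Set (Cn n)) : Prop :=
  ContDiffOn ℝ ∞ u Ω ∧ ∀ z ∈ Ω, ∀ τ : Cn n, τ ≠ 0 → 0 < (levi u z τ τ).re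

/-! ### Domains -/

/-- `Ω` admits a smooth strictly plurisubharmonic exhaustion function. -/
def IsPseudoconvex (Ω : Set (Cn n)) : Prop :=
  ∃ φ : Cn n → ℝ, IsSmoothStrictlyPSH φ Ω ∧ ∀ c : ℝ, IsCompact {z ∈ Ω | φ z ≤ c}

/-- The boundary of `Ω` is of class `C²`: near each boundary point, `Ω` is the negativity set of
a `C²` function whose differential does not vanish at that point. -/
def HasC2Boundary (Ω : Set (Cn n)) : Prop :=
  ∀ p ∈ frontier Ω, ∃ (U : Set (Cn n)) (ρ : Cn n → ℝ), IsOpen U ∧ p ∈ U ∧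
    ContDiffOn ℝ 2 ρ U ∧ fderiv ℝ ρ p ≠ 0 ∧ ∀ z ∈ U, (z ∈ Ω ↔ ρ z < 0)

/-- `δ_Ω(z)`, the distance to the boundary. -/
def bdist (Ω : Set (Cn n)) (z : Cn n) : ℝ := Metric.infDist z (frontier Ω)

open Classical in
/-- The signed distance function: `-δ_Ω` in `Ω`, `δ_Ω` outside `Ω`. -/
def signedDist (Ω : Set (Cn n)) (z : Cn n) : ℝ :=
  if z ∈ Ω then -bdist Ω z else bdist Ω z

/-! ### The Diederich–Fornæss index -/

/-- `η` is admissible: there is `ρ ∈ C²(Ω̄)` comparable to `-δ_Ω` such that `-(-ρ)^η` is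
plurisubharmonic on `Ω`. -/
def IsDFExponent (Ω : Set (Cn n)) (η : ℝ) : Prop :=
  ∃ ρ : Cn n → ℝ,
    (∃ U : Set (Cn n), IsOpen U ∧ closure Ω ⊆ U ∧ ContDiffOn ℝ 2 ρ U) ∧
    (∃ c : ℝ, 1 < c ∧ ∀ z ∈ closure Ω, -c * bdist Ω z ≤ ρ z ∧ ρ z ≤ -bdist Ω z) ∧
    IsPSH (fun z => -(-ρ z) ^ η) Ω

/-- The index `DF_{C²}(Ω)`; it is `0` if there is no admissible exponent. -/
def dfIndex (Ω : Set (Cn n)) : ℝ :=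
  sSup {η : ℝ | 0 < η ∧ η < 1 ∧ IsDFExponent Ω η}

/-! ### The one-form `α_Ω` on Levi-null vectors -/

/-- The real one-form `α_Ω = 4 ∑_j Re (∂δ̃/∂z̄_j ∂̄(∂δ̃/∂z_j))` at `z`, on a real tangent vector
`v` (so that `dz̄_k(v)` is the conjugate of `v_k`), where `δ̃` is the signed distance function. -/
def alphaReal (Ω : Set (Cn n)) (z : Cn n) (v : Cn n) : ℝ :=
  4 * ∑ j, (dzbar j (fun w => (signedDist Ω w : ℂ)) z *
    ∑ k, dzbar k (dz j (fun w => (signedDist Ω w : ℂ))) z * (starRingEnd ℂ) (v k)).re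

/-- The value of the complex-linear extension of `α_Ω` on the `(1,0)`-vector
`τ = (1/2) (v - i J v)`. -/
def alpha (Ω : Set (Cn n)) (z : Cn n) (v : Cn n) : ℂ :=
  (1 / 2) * ((alphaReal Ω z v : ℂ) - Complex.I * (alphaReal Ω z (Complex.I • v) : ℂ))

/-- The space `T^{1,0}_p(bΩ)` of complex tangential vectors at `p`. -/
def tangent10 (Ω : Set (Cn n)) (p : Cn n) : Set (Cn n) :=
  {τ | del (signedDist Ω) p τ = 0}

/-- The null space `𝒩_p(Ω)` of the Levi form at `p`. -/
def leviNull (Ω : Set (Cn n)) (p : Cn n) : Set (Cn n) :=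
  {τ ∈ tangent10 Ω p | ∀ θ ∈ tangent10 Ω p, levi (signedDist Ω) p τ θ = 0}

/-- The set of all quotients `|α_Ω(τ)| / |τ|` with `τ ∈ 𝒩_p(Ω) \ {0}` and `p ∈ bΩ`. It is empty
if `Ω` is strictly pseudoconvex. -/
def alphaRatios (Ω : Set (Cn n)) : Set ℝ :=
  {a | ∃ p ∈ frontier Ω, ∃ τ ∈ leviNull Ω p, τ ≠ 0 ∧ a = ‖alpha Ω p τ‖ / vecNorm τ}

/-- The constant `A`. The supremum of the empty set of reals is `0` here, so `A = 0` if `Ω` is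
strictly pseudoconvex. -/
def alphaSup (Ω : Set (Cn n)) : ℝ := sSup (alphaRatios Ω)

/-- `r = sup_Ω |z|`. -/
def supNorm (Ω : Set (Cn n)) : ℝ := sSup ((fun z => ‖z‖) '' Ω)

end DFIndex

end

noncomputable section

namespace DFIndex

open Filter Topology Set

/-! ### Regularity of the signed distance near a C² boundary. -/

section SignedDistance

variable {E : Type*} [NormedAddCommGroup E] [InnerProductSpace ℝ E] [CompleteSpace E]

local notation "⟪" x "," y "⟫" => inner ℝ x y

/-! Let r be the signed distance, δ = -r in Ω, g = ∇r and H the real Hessian of r. Near bΩ take ρ =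
-δ exp(C - K|z|²), so that -(-ρ)^η = -e^{ηℓ} with ℓ = log δ - K|z|² + C. This is plurisubharmonic
exactly when η|∂ℓ|² ≤ -i∂∂̄ℓ, and with σ = ∂r(τ)/δ the condition reads η|σ + K⟨z,τ⟩|² ≤ Levi_r(τ)/δ
+ |σ|² + K|τ|² (`log_weight_calculus`). Farther inside, a concave flattening makes ℓ constant, so
only the estimate near bΩ matters (`isDFExponent_of_lt`).

That estimate (`exists_boundary_estimate`) is proved by contradiction and compactness over unit
pairs (τ,σ). Two identities control the division by δ. The Hessians at z and at its foot point p
satisfy H_z = H_p + δ H_p H_z (`hessian_sgnDist_eq`), which contributes a term quadratic in Hτ.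
Writing τ = T + 2δσg with T complex tangential contributes 2 Re(σ̄c) up to O(δ), where c = ⟨g, H^ℂτ⟩
= 2α(τ) and H^ℂ is the complex-linear part of H. The remaining Levi(T)/δ is nonnegative by
pseudoconvexity (`levi_form_nonneg`), and failure of the estimate keeps it bounded, so the limit of
τ is Levi-null.

For a Levi-null vector |c| ≤ √2·A|τ| in Euclidean length, and since g is orthogonal to the image of
H, |c|² is at most the quadratic term just gained. The limiting form is thus at least |σ+c|² + K|τ|²
- η(|σ+c| + (√2·A + Kr₀)|τ|)² with r₀ = sup|z|, which is positive definite once η(√2·A + Kr₀)² <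
(1-η)K (`remainder_pos`). The best choice K = √2·A/r₀ turns this into η < 1/(1 + 4√2·A·r₀)
(`exists_weight`). -/

theorem contDiffAt_gradient {ρ : E → ℝ} {p : E} (h : ContDiffAt ℝ 2 ρ p) :
    ContDiffAt ℝ 1 (gradient ρ) p := by
  have h1 : ContDiffAt ℝ 1 (fderiv ℝ ρ) p := h.fderiv_right (by norm_num)
  exact (InnerProductSpace.toDual ℝ E).symm.contDiff.contDiffAt.comp p h1

theorem fderiv_eq_inner_gradient (ρ : E → ℝ) (p v : E) : fderiv ℝ ρ p v = ⟪gradient ρ p, v⟫ := by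
  rw [inner_gradient_left]

theorem gradient_ne_zero {ρ : E → ℝ} {p : E} (h : fderiv ℝ ρ p ≠ 0) : gradient ρ p ≠ 0 := by
  intro h0
  apply h
  ext v
  rw [fderiv_eq_inner_gradient, h0, inner_zero_left, zero_apply]

/-- Local normal coordinates along the zero set of a `C²` function with nonzero differential. -/
theorem exists_normal_coordinates [FiniteDimensional ℝ E] {ρ : E → ℝ} {p : E}
    (h : ContDiffAt ℝ 2 ρ p) (hp : ρ p = 0) (hd : gradient ρ p ≠ 0) :
    ∃ (q : E → E) (s : E → ℝ), q p = p ∧ s p = 0 ∧ ContDiffAt ℝ 1 q p ∧ ContDiffAt ℝ 1 s p ∧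
      (∀ᶠ z in 𝓝 p, q z + s z • gradient ρ (q z) = z ∧ ρ (q z) = 0) ∧
      ∀ᶠ y : E × ℝ in 𝓝 (p, 0), ρ y.1 = 0 →
        q (y.1 + y.2 • gradient ρ y.1) = y.1 ∧ s (y.1 + y.2 • gradient ρ y.1) = y.2 := by
  set G := gradient ρ with hG
  have hGc : ContDiffAt ℝ 1 G p := contDiffAt_gradient h
  -- The inverse function theorem is applied to F. Solving F(y, s) = (z, 0) gives a point y of the
  -- zero set and s with z = y + s∇ρ(y).
  let F : E × ℝ → E × ℝ := fun y => (y.1 + y.2 • G y.1, ρ y.1)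
  have hF : ContDiffAt ℝ 1 F (p, 0) := by
    have h1 : ContDiffAt ℝ 1 (fun y : E × ℝ => G y.1) (p, 0) :=
      ContDiffAt.comp (p, (0 : ℝ)) (g := G) (f := Prod.fst) hGc contDiffAt_fst
    have h2 : ContDiffAt ℝ 1 (fun y : E × ℝ => ρ y.1) (p, 0) :=
      ContDiffAt.comp (p, (0 : ℝ)) (g := ρ) (f := Prod.fst) (h.of_le (by norm_num)) contDiffAt_fst
    exact (contDiffAt_fst.add (contDiffAt_snd.smul h1)).prodMk h2
  have hder : ∀ y : E × ℝ, fderiv ℝ F (p, 0) y = (y.1 + y.2 • G p, ⟪G p, y.1⟫) := by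
    intro y
    have h1 : HasFDerivAt (fun y : E × ℝ => G y.1) ((fderiv ℝ G p).comp (ContinuousLinearMap.fst ℝ E ℝ)) (p, 0) :=
      HasFDerivAt.comp (p, (0 : ℝ)) (g := G) (f := Prod.fst)
        (hGc.differentiableAt (by norm_num)).hasFDerivAt hasFDerivAt_fst
    have h2 : HasFDerivAt (fun y : E × ℝ => ρ y.1) ((fderiv ℝ ρ p).comp (ContinuousLinearMap.fst ℝ E ℝ)) (p, 0) :=
      HasFDerivAt.comp (p, (0 : ℝ)) (g := ρ) (f := Prod.fst)
        (h.differentiableAt (by norm_num)).hasFDerivAt hasFDerivAt_fst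
    have h3 := ((hasFDerivAt_fst (𝕜 := ℝ) (p := (p, (0 : ℝ)))).add
      ((hasFDerivAt_snd (𝕜 := ℝ) (p := (p, (0 : ℝ)))).smul h1)).prodMk h2
    have h4 : HasFDerivAt F _ (p, 0) := h3
    rw [h4.fderiv]
    simp [hG]
  have hinj : Function.Injective (fderiv ℝ F (p, 0) : E × ℝ →ₗ[ℝ] E × ℝ) := by
    rw [← LinearMap.ker_eq_bot, LinearMap.ker_eq_bot']
    rintro ⟨a, b⟩ hab
    have hab' : fderiv ℝ F (p, 0) (a, b) = 0 := hab
    rw [hder] at hab'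
    simp only [Prod.mk_eq_zero] at hab'
    obtain ⟨h1, h2⟩ := hab'
    have h3 : b * ⟪G p, G p⟫ = 0 := by
      have := congrArg (fun x => ⟪G p, x⟫) h1
      simp only [inner_add_right, inner_smul_right, h2, zero_add, inner_zero_right] at this
      exact this
    have h4 : b = 0 := by
      rcases mul_eq_zero.1 h3 with h | h
      · exact h
      · exact absurd (inner_self_eq_zero.1 h) hd
    subst h4
    simp at h1
    simp [h1]
  let e : (E × ℝ) ≃L[ℝ] (E × ℝ) :=
    (LinearEquiv.ofInjectiveEndo (fderiv ℝ F (p, 0) : E × ℝ →ₗ[ℝ] E × ℝ) hinj).toContinuousLinearEquiv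
  have he : (e : E × ℝ →L[ℝ] E × ℝ) = fderiv ℝ F (p, 0) := by
    exact ContinuousLinearMap.ext fun y => rfl
  have hF' : HasFDerivAt F (e : E × ℝ →L[ℝ] E × ℝ) (p, 0) := by
    rw [he]; exact (hF.differentiableAt (by norm_num)).hasFDerivAt
  let Φ := hF.toOpenPartialHomeomorph F hF' (by norm_num)
  have hΦ : ∀ y, Φ y = F y := fun y => rfl
  have hF0 : F (p, 0) = (p, 0) := by simp [F, hp]
  have hsrc : (p, (0 : ℝ)) ∈ Φ.source := hF.mem_toOpenPartialHomeomorph_source hF' (by norm_num)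
  have htgt : (p, (0 : ℝ)) ∈ Φ.target := by
    have := Φ.map_source hsrc
    rwa [hΦ, hF0] at this
  have hsymm : Φ.symm (p, 0) = (p, 0) := by
    have := Φ.left_inv hsrc
    rwa [hΦ, hF0] at this
  have hsm : ContDiffAt ℝ 1 Φ.symm (p, 0) := by
    have := hF.to_localInverse hF' (by norm_num)
    rwa [hF0] at this
  have hin : ContDiffAt ℝ 1 (fun z : E => ((z, 0) : E × ℝ)) p := contDiffAt_id.prodMk contDiffAt_const
  have hcomp : ContDiffAt ℝ 1 (fun z : E => Φ.symm (z, 0)) p :=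
    ContDiffAt.comp p (g := Φ.symm) (f := fun z : E => ((z, 0) : E × ℝ)) hsm hin
  refine ⟨fun z => (Φ.symm (z, 0)).1, fun z => (Φ.symm (z, 0)).2, by simp [hsymm], by simp [hsymm],
    contDiffAt_fst.comp p hcomp, contDiffAt_snd.comp p hcomp, ?_, ?_⟩
  · have h1 : ∀ᶠ z in 𝓝 p, ((z, 0) : E × ℝ) ∈ Φ.target :=
      hin.continuousAt.eventually (Φ.open_target.mem_nhds htgt)
    filter_upwards [h1] with z hz
    have := Φ.right_inv hz
    rw [hΦ] at this
    simpa [F] using this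
  · filter_upwards [Φ.open_source.mem_nhds hsrc] with y hy hy0
    have := Φ.left_inv hy
    have h2 : Φ y = (y.1 + y.2 • G y.1, 0) := by rw [hΦ]; simp [F, hy0]
    rw [h2] at this
    simp [this]

/-- The normalized gradient. -/
def unitNormal (ρ : E → ℝ) (y : E) : E := ‖gradient ρ y‖⁻¹ • gradient ρ y

theorem norm_unitNormal {ρ : E → ℝ} {y : E} (h : gradient ρ y ≠ 0) : ‖unitNormal ρ y‖ = 1 := by
  rw [unitNormal, norm_smul, norm_inv, norm_norm, inv_mul_cancel₀ (norm_ne_zero_iff.2 h)]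

theorem contDiffAt_unitNormal {ρ : E → ℝ} {p : E} (h : ContDiffAt ℝ 2 ρ p)
    (hd : gradient ρ p ≠ 0) : ContDiffAt ℝ 1 (unitNormal ρ) p := by
  have hG := contDiffAt_gradient h
  exact ((hG.norm ℝ hd).inv (norm_ne_zero_iff.2 hd)).smul hG

/-- Needed to gain a derivative: the distance is built from a foot point map that is only C¹, but
its gradient is again C¹. -/
theorem contDiffAt_two_of_hasGradientAt {f : E → ℝ} {g : E → E} {p : E}
    (hf : ∀ᶠ z in 𝓝 p, HasGradientAt f (g z) z) (hg : ContDiffAt ℝ 1 g p) :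
    ContDiffAt ℝ 2 f p := by
  have : (2 : WithTop ℕ∞) = 1 + 1 := by norm_num
  rw [this]
  refine (contDiffAt_succ_iff_hasFDerivAt (n := 1)).2 ?_
  refine ⟨fun z => InnerProductSpace.toDual ℝ E (g z), ?_, ?_⟩
  · exact ⟨_, hf, fun x hx => hx.hasFDerivAt⟩
  · exact (InnerProductSpace.toDual ℝ E).contDiff.contDiffAt.comp p hg

omit [CompleteSpace E] in
theorem inner_fderiv_eq_zero_of_norm_eq_one {N : E → E} {z : E} (hN : DifferentiableAt ℝ N z)
    (h : ∀ᶠ w in 𝓝 z, ‖N w‖ = 1) (v : E) : ⟪N z, fderiv ℝ N z v⟫ = 0 := by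
  have h1 := (hN.hasFDerivAt.inner ℝ hN.hasFDerivAt)
  have h2 : (fun w => ⟪N w, N w⟫) =ᶠ[𝓝 z] fun _ => (1 : ℝ) := by
    filter_upwards [h] with w hw
    rw [real_inner_self_eq_norm_sq, hw]; norm_num
  have h3 := h1.unique ((hasFDerivAt_const (1 : ℝ) z).congr_of_eventuallyEq h2)
  have h4 := congrArg (fun L : E →L[ℝ] ℝ => L v) h3
  simp [fderivInnerCLM_apply, real_inner_comm] at h4
  linarith

/-- The foot point map and the local signed distance to the zero set of `ρ`. -/
theorem exists_footPoint [FiniteDimensional ℝ E] {ρ : E → ℝ} {p : E}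
    (h : ContDiffAt ℝ 2 ρ p) (hp : ρ p = 0) (hd : gradient ρ p ≠ 0) :
    ∃ (q : E → E) (f : E → ℝ), q p = p ∧ f p = 0 ∧ ContDiffAt ℝ 1 q p ∧ ContDiffAt ℝ 2 f p ∧
      (∀ᶠ z in 𝓝 p, HasGradientAt f (unitNormal ρ (q z)) z ∧ gradient ρ (q z) ≠ 0 ∧
        z - q z = f z • unitNormal ρ (q z) ∧ ρ (q z) = 0) ∧
      ∀ᶠ y : E × ℝ in 𝓝 (p, 0), ρ y.1 = 0 → q (y.1 + y.2 • gradient ρ y.1) = y.1 := by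
  obtain ⟨q, s, hqp, hsp, hq, hs, h1, h2⟩ := exists_normal_coordinates h hp hd
  have hνp := contDiffAt_unitNormal h hd
  have hN : ContDiffAt ℝ 1 (fun z => unitNormal ρ (q z)) p :=
    ContDiffAt.comp p (g := unitNormal ρ) (by rw [hqp]; exact hνp) hq
  have hqt : Tendsto q (𝓝 p) (𝓝 p) := by
    have := hq.continuousAt.tendsto
    rwa [hqp] at this
  have hG0 : ∀ᶠ z in 𝓝 p, gradient ρ (q z) ≠ 0 :=
    hqt.eventually ((contDiffAt_gradient h).continuousAt.eventually_ne hd)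
  have hρd : ∀ᶠ z in 𝓝 p, DifferentiableAt ℝ ρ (q z) := by
    refine hqt.eventually ?_
    filter_upwards [h.eventually (by simp)] with y hy using hy.differentiableAt (by norm_num)
  have hgrad : ∀ᶠ z in 𝓝 p, HasGradientAt (fun z => ⟪unitNormal ρ (q z), z - q z⟫)
      (unitNormal ρ (q z)) z := by
    filter_upwards [hN.eventually (by simp), hq.eventually (by simp), hρd, hG0.eventually_nhds,
      h1.eventually_nhds] with z hNz hqz hρz hGz h1z
    have hNd := (hNz.differentiableAt (by norm_num))
    have hqd := (hqz.differentiableAt (by norm_num))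
    have hf := hNd.hasFDerivAt.inner ℝ ((hasFDerivAt_id z).sub hqd.hasFDerivAt)
    rw [hasGradientAt_iff_hasFDerivAt]
    refine HasFDerivAt.congr_fderiv hf ?_
    ext v
    -- In the product rule for ⟨N∘q, z - q⟩ only ⟨N∘q, v⟩ survives: q moves inside the level set, so
    -- dq is tangent to it, while dN is orthogonal to N and z - q is a multiple of N.
    have e1 : ⟪unitNormal ρ (q z), fderiv ℝ q z v⟫ = 0 := by
      have := HasFDerivAt.comp z (g := ρ) (f := q) hρz.hasFDerivAt hqd.hasFDerivAt
      have h0 : (ρ ∘ q) =ᶠ[𝓝 z] fun _ => (0 : ℝ) := h1z.mono fun w hw => hw.2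
      have h3 := this.unique ((hasFDerivAt_const (0 : ℝ) z).congr_of_eventuallyEq h0)
      have h4 := congrArg (fun L : E →L[ℝ] ℝ => L v) h3
      simp only [ContinuousLinearMap.comp_apply, fderiv_eq_inner_gradient] at h4
      rw [unitNormal, inner_smul_left, h4]; simp
    have e2 : ⟪unitNormal ρ (q z), fderiv ℝ (fun z => unitNormal ρ (q z)) z v⟫ = 0 :=
      inner_fderiv_eq_zero_of_norm_eq_one hNd (hGz.mono fun w hw => norm_unitNormal hw) v
    have e3 : ⟪fderiv ℝ (fun z => unitNormal ρ (q z)) z v, z - q z⟫ = 0 := by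
      have h5 : z - q z = (s z * ‖gradient ρ (q z)‖) • unitNormal ρ (q z) := by
        have h6 := h1z.self_of_nhds.1
        have h7 : z - q z = s z • gradient ρ (q z) := by
          rw [sub_eq_iff_eq_add, add_comm]; exact h6.symm
        rw [h7, unitNormal, smul_smul, mul_assoc,
          mul_inv_cancel₀ (norm_ne_zero_iff.2 hGz.self_of_nhds), mul_one]
      rw [h5, inner_smul_right, real_inner_comm, e2, mul_zero]
    simp only [ContinuousLinearMap.comp_apply, ContinuousLinearMap.prod_apply,
      fderivInnerCLM_apply, sub_apply, InnerProductSpace.toDual_apply_apply,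
      Pi.sub_apply, id, ContinuousLinearMap.id_apply]
    rw [e3, inner_sub_right, e1]
    simp
  refine ⟨q, fun z => ⟪unitNormal ρ (q z), z - q z⟫, hqp, by simp [hqp], hq,
    contDiffAt_two_of_hasGradientAt hgrad hN, ?_, h2.mono fun y hy h0 => (hy h0).1⟩
  filter_upwards [hgrad, hG0, h1] with z hz hGz h1z
  refine ⟨hz, hGz, ?_, h1z.2⟩
  have h7 : z - q z = s z • gradient ρ (q z) := by
    rw [sub_eq_iff_eq_add, add_comm]; exact h1z.1.symm
  have h5 : z - q z = (s z * ‖gradient ρ (q z)‖) • unitNormal ρ (q z) := by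
    rw [h7, unitNormal, smul_smul, mul_assoc, mul_inv_cancel₀ (norm_ne_zero_iff.2 hGz), mul_one]
  rw [h5, inner_smul_right, real_inner_self_eq_norm_sq, norm_unitNormal hGz]
  simp

/-- At a nearest point of a regular level set, the displacement is normal. -/
theorem sub_eq_smul_gradient_of_nearest {ρ : E → ℝ} {y z : E} (h : ContDiffAt ℝ 1 ρ y)
    (hd : gradient ρ y ≠ 0) (hmin : ∀ᶠ w in 𝓝 y, ρ w = ρ y → ‖z - y‖ ≤ ‖z - w‖) :
    z - y = (⟪gradient ρ y, z - y⟫ / ‖gradient ρ y‖ ^ 2) • gradient ρ y := by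
  have hφ : HasStrictFDerivAt (fun w : E => ‖z - w‖ ^ 2)
      (2 • (innerSL ℝ (z - y)).comp (-ContinuousLinearMap.id ℝ E)) y :=
    (hasStrictFDerivAt_norm_sq (z - y)).comp y ((hasStrictFDerivAt_id y).const_sub z)
  have hext : IsLocalExtrOn (fun w : E => ‖z - w‖ ^ 2) {x | ρ x = ρ y} y := by
    left
    refine eventually_nhdsWithin_iff.2 ?_
    filter_upwards [hmin] with w hw hw0
    have := hw hw0
    gcongr
  obtain ⟨a, b, hab, h0⟩ := hext.exists_multipliers_of_hasStrictFDerivAt_1d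
    (h.hasStrictFDerivAt (by norm_num)) hφ
  have h1 : a • gradient ρ y = (2 * b) • (z - y) := by
    refine ext_inner_right ℝ fun v => ?_
    have := congrArg (fun L : E →L[ℝ] ℝ => L v) h0
    simp only [add_apply, smul_apply, fderiv_eq_inner_gradient, ContinuousLinearMap.comp_apply,
      neg_apply, ContinuousLinearMap.id_apply, innerSL_apply_apply, smul_eq_mul, zero_apply,
      inner_neg_right] at this
    rw [inner_smul_left, inner_smul_left]
    simp only [conj_trivial]
    have e : (2 : ℕ) • -⟪z - y, v⟫ = - (2 * ⟪z - y, v⟫) := by simp [two_mul]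
    rw [e] at this
    linarith
  have hb : b ≠ 0 := by
    rintro rfl
    simp only [mul_zero, zero_smul, smul_eq_zero, hd, or_false] at h1
    exact hab (by rw [h1]; rfl)
  have h2 : z - y = (a / (2 * b)) • gradient ρ y := by
    rw [div_eq_inv_mul, mul_smul, h1, smul_smul, inv_mul_cancel₀ (by positivity), one_smul]
  have h3 : ⟪gradient ρ y, z - y⟫ / ‖gradient ρ y‖ ^ 2 = a / (2 * b) := by
    have : ‖gradient ρ y‖ ≠ 0 := norm_ne_zero_iff.2 hd
    conv_lhs => rw [h2]
    rw [inner_smul_right, real_inner_self_eq_norm_sq]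
    field_simp
  rw [h3, ← h2]

/-- A zero of ρ outside the closure of Ω would be a local minimum of ρ, contradicting the
nonvanishing gradient. -/
theorem eventually_mem_frontier_iff {Ω U : Set E} {ρ : E → ℝ} {p : E} (hΩ : IsOpen Ω)
    (hU : IsOpen U) (hpU : p ∈ U) (hρ : ContDiffOn ℝ 2 ρ U) (hd : gradient ρ p ≠ 0)
    (hdef : ∀ z ∈ U, (z ∈ Ω ↔ ρ z < 0)) : ∀ᶠ y in 𝓝 p, (y ∈ frontier Ω ↔ ρ y = 0) := by
  have hc : ∀ y ∈ U, ContDiffAt ℝ 2 ρ y := fun y hy => hρ.contDiffAt (hU.mem_nhds hy)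
  filter_upwards [hU.mem_nhds hpU, (contDiffAt_gradient (hc p hpU)).continuousAt.eventually_ne hd]
    with y hy hdy
  rw [hΩ.frontier_eq]
  constructor
  · rintro ⟨h1, h2⟩
    rw [hdef y hy, not_lt] at h2
    refine le_antisymm ?_ h2
    by_contra! h3
    have h4 := (hc y hy).continuousAt.eventually (lt_mem_nhds h3)
    rw [mem_closure_iff_frequently] at h1
    obtain ⟨w, hw1, hw2, hw3⟩ := (h1.and_eventually (h4.and (hU.mem_nhds hy))).exists
    rw [hdef w hw3] at hw1
    linarith
  · intro h0
    refine ⟨?_, by rw [hdef y hy, h0]; simp⟩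
    by_contra hcl
    have h1 : ∀ᶠ w in 𝓝 y, ρ y ≤ ρ w := by
      filter_upwards [isClosed_closure.isOpen_compl.mem_nhds hcl, hU.mem_nhds hy] with w hw hwU
      rw [h0, ← not_lt, ← hdef w hwU]
      exact fun h => hw (subset_closure h)
    have h2 : fderiv ℝ ρ y = 0 := IsLocalMin.fderiv_eq_zero h1
    apply hdy
    rw [gradient, h2, map_zero]

open Classical in
/-- The signed distance to the boundary of a set. -/
def sgnDist (Ω : Set E) (z : E) : ℝ :=
  if z ∈ Ω then -Metric.infDist z (frontier Ω) else Metric.infDist z (frontier Ω)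

/-- Near a regular boundary point the signed distance is the local one. -/
theorem sgnDist_eventually_regular [FiniteDimensional ℝ E] {Ω U : Set E} {ρ : E → ℝ} {p : E} (hΩ : IsOpen Ω)
    (hU : IsOpen U) (hpU : p ∈ U) (hρ : ContDiffOn ℝ 2 ρ U) (hd : gradient ρ p ≠ 0)
    (hdef : ∀ z ∈ U, (z ∈ Ω ↔ ρ z < 0)) (hp : p ∈ frontier Ω) :
    ∀ᶠ z in 𝓝 p, ContDiffAt ℝ 2 (sgnDist Ω) z ∧ ‖gradient (sgnDist Ω) z‖ = 1 ∧
      z - sgnDist Ω z • gradient (sgnDist Ω) z ∈ frontier Ω ∧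
      gradient (sgnDist Ω) (z - sgnDist Ω z • gradient (sgnDist Ω) z) =
        gradient (sgnDist Ω) z := by
  have : ProperSpace E := FiniteDimensional.proper ℝ E
  have hfr := eventually_mem_frontier_iff hΩ hU hpU hρ hd hdef
  have hp0 : ρ p = 0 := hfr.self_of_nhds.1 hp
  have hc : ContDiffAt ℝ 2 ρ p := hρ.contDiffAt (hU.mem_nhds hpU)
  have hG := (contDiffAt_gradient hc).continuousAt
  obtain ⟨q, f, hqp, hfp, hq, hf, h1, h2⟩ := exists_footPoint hc hp0 hd
  have hqt : Tendsto q (𝓝 p) (𝓝 p) := by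
    have := hq.continuousAt.tendsto
    rwa [hqp] at this
  have hne : (frontier Ω).Nonempty := ⟨p, hp⟩
  choose qn hqn1 hqn2 using fun z => isClosed_frontier.exists_infDist_eq_dist hne z (s := frontier Ω)
  have hqnt : Tendsto qn (𝓝 p) (𝓝 p) := by
    rw [tendsto_iff_dist_tendsto_zero]
    have hb : ∀ z, dist (qn z) p ≤ 2 * dist z p := fun z => by
      have e1 : dist z (qn z) ≤ dist z p := by
        rw [← hqn2 z]; exact Metric.infDist_le_dist_of_mem hp
      have e2 := dist_triangle (qn z) z p
      rw [dist_comm (qn z) z] at e2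
      linarith
    refine squeeze_zero (fun _ => dist_nonneg) hb ?_
    have : Tendsto (fun z => 2 * dist z p) (𝓝 p) (𝓝 (2 * dist p p)) := by
      apply Continuous.tendsto; fun_prop
    simpa using this
  -- A nearest point also has normal displacement (Lagrange multipliers), and it tends to p with z.
  -- Uniqueness of the local normal coordinates identifies it with q z.
  have hfoot : ∀ᶠ z in 𝓝 p, q z = qn z := by
    have hsn : Tendsto (fun z => (qn z, ⟪gradient ρ (qn z), z - qn z⟫ / ‖gradient ρ (qn z)‖ ^ 2))
        (𝓝 p) (𝓝 (p, 0)) := by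
      refine hqnt.prodMk_nhds ?_
      have hGn : Tendsto (fun z => gradient ρ (qn z)) (𝓝 p) (𝓝 (gradient ρ p)) := hG.tendsto.comp hqnt
      have := (hGn.inner (𝕜 := ℝ) (tendsto_id.sub hqnt)).div (hGn.norm.pow 2)
        (pow_ne_zero 2 (norm_ne_zero_iff.2 hd))
      rw [sub_self, inner_zero_right, zero_div] at this
      exact this
    have hC1 : ∀ᶠ y in 𝓝 p, ContDiffAt ℝ 1 ρ y :=
      (hc.of_le (by norm_num)).eventually (by simp)
    filter_upwards [hsn.eventually h2, hqnt.eventually hfr.eventually_nhds, hqnt.eventually hC1,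
      hqnt.eventually (hG.eventually_ne hd)] with z hz hz2 hz3 hz4
    have h0 : ρ (qn z) = 0 := hz2.self_of_nhds.1 (hqn1 z)
    have := sub_eq_smul_gradient_of_nearest (z := z) hz3 hz4 (by
      filter_upwards [hz2] with w hw hw0
      rw [h0] at hw0
      have := Metric.infDist_le_dist_of_mem (x := z) (hw.2 hw0)
      rwa [hqn2 z, dist_eq_norm, dist_eq_norm] at this)
    have h3 := hz h0
    rw [← this] at h3
    simpa using h3
  -- Strict differentiability at p compares ρ(z) = ρ(z) - ρ(q z) with f(z)⟨∇ρ(p), N⟩. The error is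
  -- at most |f(z)||∇ρ(p)|/2 and the inner product exceeds |∇ρ(p)|/2, so ρ and f have the same sign.
  have hsign : ∀ᶠ z in 𝓝 p, (z ∈ Ω ↔ f z < 0) := by
    have hst := (hc.of_le (m := 1) (by norm_num)).hasStrictFDerivAt (by norm_num)
    have hpos : 0 < ‖gradient ρ p‖ := norm_pos_iff.2 hd
    have hlo := (hst.isLittleO.def (c := ‖gradient ρ p‖ / 2) (by positivity))
    have ht : Tendsto (fun z => (z, q z)) (𝓝 p) (𝓝 (p, p)) := tendsto_id.prodMk_nhds hqt
    have hν : Tendsto (fun z => ⟪gradient ρ p, unitNormal ρ (q z)⟫) (𝓝 p) (𝓝 ‖gradient ρ p‖) := by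
      have e1 := ((contDiffAt_unitNormal hc hd).continuousAt.tendsto.comp hqt)
      have e2 := (tendsto_const_nhds (x := gradient ρ p) (f := 𝓝 p)).inner e1 (𝕜 := ℝ)
      have e3 : ‖gradient ρ p‖ = ⟪gradient ρ p, unitNormal ρ p⟫ := by
        rw [unitNormal, inner_smul_right, real_inner_self_eq_norm_sq]
        field_simp
      rw [e3]
      exact e2
    filter_upwards [ht.eventually hlo, h1, hν.eventually (lt_mem_nhds (half_lt_self hpos)),
      hU.mem_nhds hpU] with z hz h1z hνz hzU
    obtain ⟨-, hg0, hzq, hq0⟩ := h1z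
    rw [hdef z hzU]
    rw [hzq, hq0, sub_zero, fderiv_eq_inner_gradient, inner_smul_right, norm_smul,
      norm_unitNormal hg0, mul_one, Real.norm_eq_abs, Real.norm_eq_abs, abs_le] at hz
    obtain ⟨hz1, hz2⟩ := hz
    constructor
    · intro hneg
      by_contra! hfz
      rw [abs_of_nonneg hfz] at hz1
      nlinarith
    · intro hneg
      rw [abs_of_neg hneg] at hz2
      nlinarith
  have heq : sgnDist Ω =ᶠ[𝓝 p] f := by
    filter_upwards [hfoot, hsign, h1] with z hz hs h1z
    have h3 : Metric.infDist z (frontier Ω) = |f z| := by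
      rw [hqn2 z, ← hz, dist_eq_norm, h1z.2.2.1, norm_smul, norm_unitNormal h1z.2.1, mul_one,
        Real.norm_eq_abs]
    rw [sgnDist, h3]
    split_ifs with hzΩ
    · rw [abs_of_neg (hs.1 hzΩ)]; ring
    · rw [abs_of_nonneg (not_lt.1 (fun h => hzΩ (hs.2 h)))]
  have hgr : ∀ᶠ z in 𝓝 p, gradient (sgnDist Ω) z = unitNormal ρ (q z) := by
    filter_upwards [heq.eventually_nhds, h1] with z hz h1z
    exact (h1z.1.congr_of_eventuallyEq hz).gradient
  have hqq : ∀ᶠ z in 𝓝 p, q (q z) = q z := by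
    have ht : Tendsto (fun z => (q z, (0 : ℝ))) (𝓝 p) (𝓝 (p, 0)) := hqt.prodMk_nhds tendsto_const_nhds
    filter_upwards [ht.eventually h2, h1] with z hz h1z
    simpa using hz h1z.2.2.2
  filter_upwards [heq, hgr, h1, hqq, hqt.eventually hgr, hqt.eventually hfr,
    (hf.congr_of_eventuallyEq heq).eventually (by simp)] with z hz hgz h1z hqz hgq hfrq hcd
  have e : z - sgnDist Ω z • gradient (sgnDist Ω) z = q z := by
    rw [hz, hgz, ← h1z.2.2.1]; abel
  rw [e]
  refine ⟨hcd, ?_, hfrq.2 h1z.2.2.2, ?_⟩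
  · rw [hgz, norm_unitNormal h1z.2.1]
  · rw [hgq, hqz, hgz]

end SignedDistance

/-! ### Second order expansion and the Riccati equation for the Hessian of the distance. -/

section SecondOrder

variable {E : Type*} [NormedAddCommGroup E]

/-- Second order Taylor expansion with Peano remainder. -/
theorem taylor_two_isLittleO [NormedSpace ℝ E] {u : E → ℝ} {z : E} (h : ContDiffAt ℝ 2 u z) :
    (fun w => u (z + w) - u z - fderiv ℝ u z w - fderiv ℝ (fderiv ℝ u) z w w / 2)
      =o[𝓝 0] fun w => ‖w‖ ^ 2 := by
  have hsym := h.isSymmSndFDerivAt (by simp)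
  have hD : HasFDerivAt (fderiv ℝ u) (fderiv ℝ (fderiv ℝ u) z) z :=
    ((h.fderiv_right (m := 1) (by norm_num)).differentiableAt (by norm_num)).hasFDerivAt
  have hd : ∀ᶠ w in 𝓝 (0 : E), DifferentiableAt ℝ u (z + w) := by
    have ht : Tendsto (fun w : E => z + w) (𝓝 0) (𝓝 z) := by
      have : Continuous fun w : E => z + w := by fun_prop
      simpa using this.tendsto 0
    refine ht.eventually ?_
    filter_upwards [h.eventually (by simp)] with y hy using hy.differentiableAt (by norm_num)
  set B := fderiv ℝ (fderiv ℝ u) z with hB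
  rw [Asymptotics.isLittleO_iff]
  intro ε hε
  have h1 := (hasFDerivAt_iff_isLittleO_nhds_zero.1 hD).def hε
  obtain ⟨δ, hδ, hball⟩ := Metric.eventually_nhds_iff_ball.1 (h1.and hd)
  filter_upwards [Metric.ball_mem_nhds (0 : E) hδ] with w hw
  have hw' : ‖w‖ < δ := by simpa using hw
  have hsub : Metric.closedBall (0 : E) ‖w‖ ⊆ Metric.ball 0 δ := Metric.closedBall_subset_ball hw'
  -- The remainder has derivative ∇u(z+v) - ∇u(z) - Bv, by symmetry of B. This is at most ε‖w‖ on
  -- the ball, and the mean value inequality supplies the second factor ‖w‖.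
  have hder : ∀ v ∈ Metric.closedBall (0 : E) ‖w‖,
      HasFDerivWithinAt (fun w => u (z + w) - u z - fderiv ℝ u z w - B w w / 2)
        (fderiv ℝ u (z + v) - fderiv ℝ u z - B v) (Metric.closedBall (0 : E) ‖w‖) v := by
    intro v hv
    have e1 : HasFDerivAt (fun w => u (z + w)) (fderiv ℝ u (z + v)) v := by
      have := HasFDerivAt.comp v (g := u) (f := fun w => z + w) (hball v (hsub hv)).2.hasFDerivAt
        ((hasFDerivAt_id v).const_add z)
      exact this
    have e2 : HasFDerivAt (fun w => B w w) (B v + B.flip v) v := by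
      have := (B.hasFDerivAt (x := v)).clm_apply (hasFDerivAt_id v)
      exact this
    have e3 := (((e1.sub_const (u z)).sub ((fderiv ℝ u z).hasFDerivAt (x := v))).sub
      (e2.mul_const (2⁻¹ : ℝ))).hasFDerivWithinAt (s := Metric.closedBall (0 : E) ‖w‖)
    simp only [div_eq_mul_inv]
    refine e3.congr_fderiv ?_
    ext x
    have := hsym.eq v x
    simp only [sub_apply, smul_apply, add_apply, ContinuousLinearMap.flip_apply, smul_eq_mul]
    rw [hB, this]
    ring
  have hbd : ∀ v ∈ Metric.closedBall (0 : E) ‖w‖,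
      ‖fderiv ℝ u (z + v) - fderiv ℝ u z - B v‖ ≤ ε * ‖w‖ := by
    intro v hv
    refine (hball v (hsub hv)).1.trans ?_
    have : ‖v‖ ≤ ‖w‖ := by simpa using hv
    gcongr
  have := (convex_closedBall (0 : E) ‖w‖).norm_image_sub_le_of_norm_hasFDerivWithin_le hder hbd
    (x := 0) (y := w) (by simp) (by simp)
  simp only [add_zero, sub_self, map_zero, zero_div, sub_zero] at this
  rw [norm_pow, norm_norm, pow_two, ← mul_assoc]
  simpa using this

variable [InnerProductSpace ℝ E] [CompleteSpace E]

local notation "⟪" x "," y "⟫" => inner ℝ x y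

theorem inner_fderiv_gradient {u : E → ℝ} {z : E} (h : ContDiffAt ℝ 2 u z) (v w : E) :
    ⟪fderiv ℝ (gradient u) z v, w⟫ = fderiv ℝ (fderiv ℝ u) z v w := by
  have hD : DifferentiableAt ℝ (fderiv ℝ u) z :=
    (h.fderiv_right (m := 1) (by norm_num)).differentiableAt (by norm_num)
  have := HasFDerivAt.comp z (g := (InnerProductSpace.toDual ℝ E).symm)
    ((InnerProductSpace.toDual ℝ E).symm.toContinuousLinearEquiv.hasFDerivAt) hD.hasFDerivAt
  have h2 : HasFDerivAt (gradient u) _ z := this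
  rw [h2.fderiv]
  simp

theorem inner_fderiv_gradient_comm {u : E → ℝ} {z : E} (h : ContDiffAt ℝ 2 u z) (v w : E) :
    ⟪fderiv ℝ (gradient u) z v, w⟫ = ⟪fderiv ℝ (gradient u) z w, v⟫ := by
  rw [inner_fderiv_gradient h, inner_fderiv_gradient h]
  exact (h.isSymmSndFDerivAt (by simp)).eq v w

/-- The points near which the signed distance is `C²`, has a unit gradient, and has a foot point
with the same gradient. -/
def regularSet (Ω : Set E) : Set E :=
  {p | ∀ᶠ z in 𝓝 p, ContDiffAt ℝ 2 (sgnDist Ω) z ∧ ‖gradient (sgnDist Ω) z‖ = 1 ∧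
      z - sgnDist Ω z • gradient (sgnDist Ω) z ∈ frontier Ω ∧
      gradient (sgnDist Ω) (z - sgnDist Ω z • gradient (sgnDist Ω) z) =
        gradient (sgnDist Ω) z}

theorem isOpen_regularSet (Ω : Set E) : IsOpen (regularSet Ω) := isOpen_setOfPred_eventually_nhds

omit [InnerProductSpace ℝ E] [CompleteSpace E] in
theorem sgnDist_of_mem_frontier {Ω : Set E} {z : E} (h : z ∈ frontier Ω) :
    sgnDist Ω z = 0 := by
  simp [sgnDist, Metric.infDist_zero_of_mem h]

/-- By symmetry of the Hessian, ⟨H∇u, v⟩ = ⟨Hv, ∇u⟩, which is half the derivative of |∇u|² = 1. -/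
theorem fderiv_gradient_apply_gradient {u : E → ℝ} {z : E} (h : ContDiffAt ℝ 2 u z)
    (h1 : ∀ᶠ w in 𝓝 z, ‖gradient u w‖ = 1) : fderiv ℝ (gradient u) z (gradient u z) = 0 := by
  refine ext_inner_right ℝ fun v => ?_
  rw [inner_fderiv_gradient_comm h, inner_zero_left, real_inner_comm]
  exact inner_fderiv_eq_zero_of_norm_eq_one
    ((contDiffAt_gradient h).differentiableAt (by norm_num)) h1 v

/-- Along a normal the Hessian of the signed distance solves a Riccati equation. -/
theorem hessian_sgnDist_eq {Ω : Set E} {z : E} (hz : z ∈ regularSet Ω)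
    (hfr : frontier Ω ⊆ regularSet Ω) (v : E) :
    fderiv ℝ (gradient (sgnDist Ω)) z v =
      fderiv ℝ (gradient (sgnDist Ω)) (z - sgnDist Ω z • gradient (sgnDist Ω) z) v -
        sgnDist Ω z • fderiv ℝ (gradient (sgnDist Ω)) (z - sgnDist Ω z • gradient (sgnDist Ω) z)
          (fderiv ℝ (gradient (sgnDist Ω)) z v) := by
  set r := sgnDist Ω with hr
  obtain ⟨hc, hn, hf, hg⟩ := hz.self_of_nhds
  have hp : z - r z • gradient r z ∈ regularSet Ω := hfr hf
  set p := z - r z • gradient r z with hpdef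
  have hcp := hp.self_of_nhds.1
  -- Differentiating ∇r(z - r(z)∇r(z)) = ∇r(z) produces a term dr(v)·H_p∇r(z). It vanishes because z
  -- and p share the gradient, which H_p kills.
  have hHp : fderiv ℝ (gradient r) p (gradient r z) = 0 := by
    rw [← hg]
    exact fderiv_gradient_apply_gradient hcp (hp.mono fun w hw => hw.2.1)
  have hGz := ((contDiffAt_gradient hc).differentiableAt (by norm_num)).hasFDerivAt
  have hGp := ((contDiffAt_gradient hcp).differentiableAt (by norm_num)).hasFDerivAt
  have hrz := (hc.differentiableAt (by norm_num)).hasFDerivAt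
  have h1 := (hasFDerivAt_id z).sub (hrz.smul hGz)
  have h2 := HasFDerivAt.comp z (g := gradient r) (f := fun y => y - r y • gradient r y) hGp h1
  have h3 : (gradient r ∘ fun y => y - r y • gradient r y) =ᶠ[𝓝 z] gradient r :=
    hz.mono fun y hy => hy.2.2.2
  have h4 := (hGz.congr_of_eventuallyEq h3).unique h2
  have h5 := congrArg (fun L : E →L[ℝ] E => L v) h4
  have hHp' : fderiv ℝ (gradient (sgnDist Ω)) p (gradient (sgnDist Ω) z) = 0 := hHp
  simpa [hHp'] using h5

end SecondOrder

/-! ### Wirtinger derivatives expressed by the real gradient and Hessian. -/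

section Wirtinger

variable {n : ℕ}

theorem real_inner_eq_re (x y : Cn n) : inner ℝ x y = (inner ℂ x y).re := by
  rw [PiLp.inner_apply, PiLp.inner_apply, Complex.re_sum]
  rfl

theorem smul_eq_re_add_im (c : ℂ) (v : Cn n) : c • v = c.re • v + c.im • (Complex.I • v) := by
  ext i
  simp only [PiLp.smul_apply, PiLp.add_apply, smul_eq_mul, Complex.real_smul]
  conv_lhs => rw [← Complex.re_add_im c]
  ring

theorem real_smul_eq (a : ℝ) (v : Cn n) : a • v = (a : ℂ) • v := by
  ext i
  simp

/-- The complex-linear part of a real-linear map. -/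
def clinPart (L : Cn n →L[ℝ] Cn n) : Cn n →ₗ[ℂ] Cn n where
  toFun v := (1 / 2 : ℂ) • (L v - Complex.I • L (Complex.I • v))
  map_add' v w := by
    simp only [map_add, smul_add, smul_sub]
    abel
  map_smul' c v := by
    have h1 : L (c • v) = (c.re : ℂ) • L v + (c.im : ℂ) • L (Complex.I • v) := by
      rw [smul_eq_re_add_im, map_add, L.map_smul, L.map_smul, real_smul_eq, real_smul_eq]
    have h2 : L (Complex.I • c • v) = (c.re : ℂ) • L (Complex.I • v) - (c.im : ℂ) • L v := by
      have : Complex.I • c • v = c.re • (Complex.I • v) + (-c.im) • v := by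
        rw [smul_smul, smul_eq_re_add_im (Complex.I * c)]
        have e1 : (Complex.I * c).re = -c.im := by simp
        have e2 : (Complex.I * c).im = c.re := by simp
        rw [e1, e2, add_comm]
      rw [this, map_add, L.map_smul, L.map_smul, real_smul_eq, real_smul_eq]
      push_cast
      rw [neg_smul, sub_eq_add_neg]
    rw [h1, h2]
    simp only [RingHom.id_apply]
    ext i
    simp only [PiLp.smul_apply, PiLp.add_apply, PiLp.sub_apply, smul_eq_mul]
    conv_rhs => rw [← Complex.re_add_im c]
    linear_combination ((c.im : ℂ) * L (Complex.I • v) i / 2) * Complex.I_sq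

theorem clinPart_apply (L : Cn n →L[ℝ] Cn n) (v : Cn n) :
    clinPart L v = (1 / 2 : ℂ) • (L v - Complex.I • L (Complex.I • v)) := rfl

theorem clinPart_eq_sum (L : Cn n →L[ℝ] Cn n) (τ : Cn n) (k : Fin n) :
    clinPart L τ k = ∑ j, clinPart L (EuclideanSpace.single j 1) k * τ j := by
  have h : τ = ∑ j, τ j • EuclideanSpace.single j (1 : ℂ) := by
    ext i
    simp [Pi.single_apply]
  conv_lhs => rw [h, map_sum]
  simp [mul_comm]

theorem single_I (j : Fin n) :
    (EuclideanSpace.single j Complex.I : Cn n) = Complex.I • EuclideanSpace.single j (1 : ℂ) := by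
  ext i
  simp [PiLp.single_apply]

theorem dz_eq_of_hasFDerivAt {f : Cn n → ℂ} {z : Cn n} {f' : Cn n →L[ℝ] ℂ}
    (h : HasFDerivAt f f' z) (j : Fin n) :
    dz j f z = (1 / 2) * (f' (EuclideanSpace.single j 1)
      - Complex.I * f' (Complex.I • EuclideanSpace.single j 1)) := by
  rw [dz, h.fderiv, single_I]

theorem dzbar_eq_of_hasFDerivAt {f : Cn n → ℂ} {z : Cn n} {f' : Cn n →L[ℝ] ℂ}
    (h : HasFDerivAt f f' z) (j : Fin n) :
    dzbar j f z = (1 / 2) * (f' (EuclideanSpace.single j 1)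
      + Complex.I * f' (Complex.I • EuclideanSpace.single j 1)) := by
  rw [dzbar, h.fderiv, single_I]

theorem hasFDerivAt_ofReal_comp {u : Cn n → ℝ} {z : Cn n} (h : DifferentiableAt ℝ u z) :
    HasFDerivAt (fun w => (u w : ℂ)) (Complex.ofRealCLM.comp (fderiv ℝ u z)) z :=
  Complex.ofRealCLM.hasFDerivAt.comp z h.hasFDerivAt

theorem fderiv_single {u : Cn n → ℝ} {z : Cn n} (j : Fin n) :
    fderiv ℝ u z (EuclideanSpace.single j 1) = (gradient u z j).re := by
  rw [fderiv_eq_inner_gradient, real_inner_eq_re, EuclideanSpace.inner_single_right]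
  simp

theorem fderiv_I_single {u : Cn n → ℝ} {z : Cn n} (j : Fin n) :
    fderiv ℝ u z (Complex.I • EuclideanSpace.single j 1) = (gradient u z j).im := by
  rw [← single_I, fderiv_eq_inner_gradient, real_inner_eq_re, EuclideanSpace.inner_single_right]
  simp

/-- The real gradient, read as a vector of ℂⁿ, has coordinates 2∂u/∂z̄_j. This dictionary replaces
all coordinate sums by inner products. -/
theorem dz_ofReal {u : Cn n → ℝ} {z : Cn n} (h : DifferentiableAt ℝ u z) (j : Fin n) :
    dz j (fun w => (u w : ℂ)) z = (1 / 2) * (starRingEnd ℂ) (gradient u z j) := by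
  rw [dz_eq_of_hasFDerivAt (hasFDerivAt_ofReal_comp h)]
  simp only [ContinuousLinearMap.comp_apply, fderiv_single, fderiv_I_single,
    Complex.ofRealCLM_apply]
  congr 1
  apply Complex.ext <;> simp

theorem dzbar_ofReal {u : Cn n → ℝ} {z : Cn n} (h : DifferentiableAt ℝ u z) (j : Fin n) :
    dzbar j (fun w => (u w : ℂ)) z = (1 / 2) * gradient u z j := by
  rw [dzbar_eq_of_hasFDerivAt (hasFDerivAt_ofReal_comp h)]
  simp only [ContinuousLinearMap.comp_apply, fderiv_single, fderiv_I_single,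
    Complex.ofRealCLM_apply]
  congr 1
  apply Complex.ext <;> simp

theorem del_eq_inner {u : Cn n → ℝ} {z : Cn n} (h : DifferentiableAt ℝ u z) (τ : Cn n) :
    del u z τ = (1 / 2) * inner ℂ (gradient u z) τ := by
  simp only [del, dz_ofReal h, PiLp.inner_apply, Finset.mul_sum, RCLike.inner_apply]
  refine Finset.sum_congr rfl fun j _ => ?_
  ring

/-- The `k`-th coordinate as a real-linear functional. -/
def coordCLM (k : Fin n) : Cn n →L[ℝ] ℂ := PiLp.proj 2 (fun _ : Fin n => ℂ) k

theorem coordCLM_apply (k : Fin n) (v : Cn n) : coordCLM k v = v k := rfl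

theorem hasFDerivAt_gradient_coord {u : Cn n → ℝ} {z : Cn n} (h : ContDiffAt ℝ 2 u z) (k : Fin n) :
    HasFDerivAt (fun w => gradient u w k)
      ((coordCLM k).comp (fderiv ℝ (gradient u) z)) z :=
  (coordCLM k).hasFDerivAt.comp z
    ((contDiffAt_gradient h).differentiableAt (by norm_num)).hasFDerivAt

theorem eventually_differentiableAt {u : Cn n → ℝ} {z : Cn n} (h : ContDiffAt ℝ 2 u z) :
    ∀ᶠ w in 𝓝 z, DifferentiableAt ℝ u w := by
  filter_upwards [h.eventually (by simp)] with w hw using hw.differentiableAt (by norm_num)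

theorem dz_dzbar_ofReal {u : Cn n → ℝ} {z : Cn n} (h : ContDiffAt ℝ 2 u z) (j k : Fin n) :
    dz j (dzbar k (fun w => (u w : ℂ))) z =
      (1 / 2) * clinPart (fderiv ℝ (gradient u) z) (EuclideanSpace.single j 1) k := by
  have h1 : dzbar k (fun w => (u w : ℂ)) =ᶠ[𝓝 z] fun w => (1 / 2) * gradient u w k := by
    filter_upwards [eventually_differentiableAt h] with w hw using dzbar_ofReal hw k
  rw [dz_eq_of_hasFDerivAt
    (((hasFDerivAt_gradient_coord h k).const_mul (1 / 2)).congr_of_eventuallyEq h1)]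
  simp only [smul_apply, ContinuousLinearMap.comp_apply, coordCLM_apply, smul_eq_mul,
    clinPart_apply, PiLp.smul_apply, PiLp.sub_apply]
  ring

theorem dzbar_dz_ofReal {u : Cn n → ℝ} {z : Cn n} (h : ContDiffAt ℝ 2 u z) (j k : Fin n) :
    dzbar k (dz j (fun w => (u w : ℂ))) z = (1 / 2) * (starRingEnd ℂ)
      (clinPart (fderiv ℝ (gradient u) z) (EuclideanSpace.single k 1) j) := by
  have h1 : dz j (fun w => (u w : ℂ)) =ᶠ[𝓝 z]
      fun w => (1 / 2) * (starRingEnd ℂ) (gradient u w j) := by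
    filter_upwards [eventually_differentiableAt h] with w hw using dz_ofReal hw j
  have h2 : HasFDerivAt (fun w => (starRingEnd ℂ) (gradient u w j))
      ((Complex.conjCLE : ℂ →L[ℝ] ℂ).comp
        ((coordCLM j).comp (fderiv ℝ (gradient u) z))) z :=
    (Complex.conjCLE : ℂ →L[ℝ] ℂ).hasFDerivAt.comp z (hasFDerivAt_gradient_coord h j)
  rw [dzbar_eq_of_hasFDerivAt ((h2.const_mul (1 / 2)).congr_of_eventuallyEq h1)]
  simp only [smul_apply, ContinuousLinearMap.comp_apply, coordCLM_apply, smul_eq_mul,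
    clinPart_apply, PiLp.smul_apply, PiLp.sub_apply, ContinuousLinearEquiv.coe_coe,
    Complex.conjCLE_apply, map_mul, map_sub, Complex.conj_I, map_div₀, map_one, map_ofNat]
  ring

theorem levi_eq_inner {u : Cn n → ℝ} {z : Cn n} (h : ContDiffAt ℝ 2 u z) (τ θ : Cn n) :
    levi u z τ θ = (1 / 2) * inner ℂ θ (clinPart (fderiv ℝ (gradient u) z) τ) := by
  simp only [levi, dz_dzbar_ofReal h, PiLp.inner_apply, Finset.mul_sum, RCLike.inner_apply]
  rw [Finset.sum_comm]
  refine Finset.sum_congr rfl fun k _ => ?_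
  rw [clinPart_eq_sum, Finset.sum_mul, Finset.mul_sum]
  refine Finset.sum_congr rfl fun j _ => ?_
  ring

theorem inner_clinPart_self_re (L : Cn n →L[ℝ] Cn n) (τ : Cn n) :
    (inner ℂ τ (clinPart L τ)).re =
      (inner ℝ τ (L τ) + inner ℝ (Complex.I • τ) (L (Complex.I • τ))) / 2 := by
  rw [clinPart_apply, real_inner_eq_re, real_inner_eq_re, inner_smul_right, inner_sub_right,
    inner_smul_right, inner_smul_left]
  simp
  ring

theorem levi_self_re {u : Cn n → ℝ} {z : Cn n} (h : ContDiffAt ℝ 2 u z) (τ : Cn n) :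
    (levi u z τ τ).re = (fderiv ℝ (fderiv ℝ u) z τ τ +
      fderiv ℝ (fderiv ℝ u) z (Complex.I • τ) (Complex.I • τ)) / 4 := by
  rw [levi_eq_inner h, ← inner_fderiv_gradient h, ← inner_fderiv_gradient h,
    real_inner_comm, real_inner_comm (Complex.I • τ)]
  have := inner_clinPart_self_re (fderiv ℝ (gradient u) z) τ
  have h2 : ((1 / 2 : ℂ) * inner ℂ τ (clinPart (fderiv ℝ (gradient u) z) τ)).re =
      (1 / 2) * (inner ℂ τ (clinPart (fderiv ℝ (gradient u) z) τ)).re := by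
    rw [show (1 / 2 : ℂ) = ((1 / 2 : ℝ) : ℂ) by push_cast; rfl, Complex.re_ofReal_mul]
  rw [h2, this]
  ring

theorem signedDist_eq_sgnDist (Ω : Set (Cn n)) : signedDist Ω = sgnDist Ω := rfl

theorem alphaReal_eq {Ω : Set (Cn n)} {z : Cn n} (h : ContDiffAt ℝ 2 (sgnDist Ω) z) (v : Cn n) :
    alphaReal Ω z v = (inner ℂ (gradient (sgnDist Ω) z)
      (clinPart (fderiv ℝ (gradient (sgnDist Ω)) z) v)).re := by
  rw [alphaReal, signedDist_eq_sgnDist, PiLp.inner_apply, Complex.re_sum, Finset.mul_sum]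
  refine Finset.sum_congr rfl fun j _ => ?_
  rw [dzbar_ofReal (h.differentiableAt (by norm_num))]
  simp only [dzbar_dz_ofReal h]
  have h1 : ∑ k, 1 / 2 * (starRingEnd ℂ) (clinPart (fderiv ℝ (gradient (sgnDist Ω)) z)
      (EuclideanSpace.single k 1) j) * (starRingEnd ℂ) (v k) =
      1 / 2 * (starRingEnd ℂ) (clinPart (fderiv ℝ (gradient (sgnDist Ω)) z) v j) := by
    rw [clinPart_eq_sum _ v, map_sum, Finset.mul_sum]
    refine Finset.sum_congr rfl fun k _ => ?_
    rw [map_mul]; ring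
  rw [h1, RCLike.inner_apply]
  simp
  ring

/-- The real form is the real part of the complex-linear functional λ(v) = ⟨g, H^ℂv⟩, so Re λ(v) - i
Re λ(iv) = λ(v). The factor 1/2 comes from τ = (v - iJv)/2. -/
theorem alpha_eq {Ω : Set (Cn n)} {z : Cn n} (h : ContDiffAt ℝ 2 (sgnDist Ω) z) (v : Cn n) :
    alpha Ω z v = (1 / 2) * inner ℂ (gradient (sgnDist Ω) z)
      (clinPart (fderiv ℝ (gradient (sgnDist Ω)) z) v) := by
  rw [alpha, alphaReal_eq h, alphaReal_eq h, map_smul, inner_smul_right]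
  congr 1
  apply Complex.ext <;> simp

end Wirtinger

/-! ### An exhaustion function forces a nonnegative Levi form on the boundary. -/

section Pseudoconvexity

variable {n : ℕ}

theorem norm_add_sq_smul_sub (A B : Cn n) :
    Tendsto (fun ζ : ℂ => ‖ζ • A + ζ ^ 2 • B‖ + ‖ζ • A‖) (𝓝 0) (𝓝 0) := by
  have : Continuous fun ζ : ℂ => ‖ζ • A + ζ ^ 2 • B‖ + ‖ζ • A‖ := by fun_prop
  simpa using this.tendsto 0

/-- Second order expansion along a quadratic holomorphic disc. -/
theorem taylor_two_disc {u : Cn n → ℝ} {x : Cn n} (h : ContDiffAt ℝ 2 u x) (A B : Cn n) :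
    (fun ζ : ℂ => u (x + (ζ • A + ζ ^ 2 • B)) - u x - fderiv ℝ u x (ζ • A + ζ ^ 2 • B)
      - fderiv ℝ (fderiv ℝ u) x (ζ • A) (ζ • A) / 2) =o[𝓝 0] fun ζ => ‖ζ‖ ^ 2 := by
  set H := fderiv ℝ (fderiv ℝ u) x
  have hcont : Continuous fun ζ : ℂ => ζ • A + ζ ^ 2 • B := by fun_prop
  have ht : Tendsto (fun ζ : ℂ => ζ • A + ζ ^ 2 • B) (𝓝 0) (𝓝 0) := by
    simpa using hcont.tendsto 0
  have hbig : (fun ζ : ℂ => ζ • A + ζ ^ 2 • B) =O[𝓝 0] fun ζ => ζ := by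
    refine Asymptotics.IsBigO.of_bound (‖A‖ + ‖B‖) ?_
    filter_upwards [Metric.ball_mem_nhds (0 : ℂ) one_pos] with ζ hζ
    have hζ1 : ‖ζ‖ < 1 := by simpa using hζ
    calc ‖ζ • A + ζ ^ 2 • B‖ ≤ ‖ζ‖ * ‖A‖ + ‖ζ‖ ^ 2 * ‖B‖ := by
          refine (norm_add_le _ _).trans ?_
          rw [norm_smul, norm_smul, norm_pow]
      _ ≤ ‖ζ‖ * ‖A‖ + ‖ζ‖ * ‖B‖ := by
          have : ‖ζ‖ ^ 2 ≤ ‖ζ‖ := by nlinarith [norm_nonneg ζ]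
          gcongr
      _ = (‖A‖ + ‖B‖) * ‖ζ‖ := by ring
  have h1 := ((taylor_two_isLittleO h).comp_tendsto ht).trans_isBigO (hbig.norm_norm.pow 2)
  have h2 : (fun ζ : ℂ => H (ζ • A + ζ ^ 2 • B) (ζ • A + ζ ^ 2 • B) / 2 - H (ζ • A) (ζ • A) / 2)
      =o[𝓝 0] fun ζ => ‖ζ‖ ^ 2 := by
    rw [Asymptotics.isLittleO_iff]
    intro c hc
    have h3 : Tendsto (fun ζ : ℂ => ‖H‖ * (‖ζ • A + ζ ^ 2 • B‖ + ‖ζ • A‖) * ‖B‖) (𝓝 0) (𝓝 0) := by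
      simpa using ((norm_add_sq_smul_sub A B).const_mul ‖H‖).mul_const ‖B‖
    filter_upwards [h3.eventually (gt_mem_nhds hc)] with ζ hζ
    have e : H (ζ • A + ζ ^ 2 • B) (ζ • A + ζ ^ 2 • B) / 2 - H (ζ • A) (ζ • A) / 2 =
        (H (ζ • A + ζ ^ 2 • B) (ζ ^ 2 • B) + H (ζ ^ 2 • B) (ζ • A)) / 2 := by
      simp only [map_add, add_apply]
      ring
    have b1 := H.le_opNorm₂ (ζ • A + ζ ^ 2 • B) (ζ ^ 2 • B)
    have b2 := H.le_opNorm₂ (ζ ^ 2 • B) (ζ • A)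
    have b3 := norm_add_le (H (ζ • A + ζ ^ 2 • B) (ζ ^ 2 • B)) (H (ζ ^ 2 • B) (ζ • A))
    have b4 : ‖ζ ^ 2 • B‖ = ‖ζ‖ ^ 2 * ‖B‖ := by rw [norm_smul, norm_pow]
    rw [b4] at b1 b2
    rw [e, norm_div, norm_pow, norm_norm, Real.norm_ofNat]
    have b5 : ‖H‖ * (‖ζ • A + ζ ^ 2 • B‖ + ‖ζ • A‖) * ‖B‖ * ‖ζ‖ ^ 2 ≤ c * ‖ζ‖ ^ 2 := by gcongr
    have b6 : 0 ≤ ‖H (ζ • A + ζ ^ 2 • B) (ζ ^ 2 • B) + H (ζ ^ 2 • B) (ζ • A)‖ := norm_nonneg _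
    linarith
  refine (h1.add h2).congr_left fun ζ => ?_
  simp only [Function.comp_apply, H]
  ring

/-- The sub-mean value property at second order: a local maximum on a holomorphic disc forces the
complex Hessian to be nonpositive in the direction of the disc. -/
theorem hessian_nonpos_of_disc_max {u : Cn n → ℝ} {x : Cn n} (h : ContDiffAt ℝ 2 u x) (A B : Cn n)
    (hmax : ∀ᶠ ζ : ℂ in 𝓝 0, u (x + (ζ • A + ζ ^ 2 • B)) ≤ u x) :
    fderiv ℝ (fderiv ℝ u) x A A +
      fderiv ℝ (fderiv ℝ u) x (Complex.I • A) (Complex.I • A) ≤ 0 := by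
  set H := fderiv ℝ (fderiv ℝ u) x
  set S := H A A + H (Complex.I • A) (Complex.I • A) with hS
  by_contra! hpos
  have hT := taylor_two_disc h A B
  have hev := (hT.def (c := S / 8) (by positivity)).and hmax
  have hdir : ∀ c : ℂ, Tendsto (fun s : ℝ => (s : ℂ) * c) (𝓝 0) (𝓝 0) := fun c => by
    have : Continuous fun s : ℝ => (s : ℂ) * c := by fun_prop
    simpa using this.tendsto 0
  -- Sampling ζ = ±s, ±is replaces the circle average: both ζ and ζ² sum to zero over these four
  -- points, so only the Hessian part S remains.
  have hall := ((hdir 1).eventually hev).and (((hdir (-1)).eventually hev).and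
    (((hdir Complex.I).eventually hev).and ((hdir (-Complex.I)).eventually hev)))
  have hnt : ∃ᶠ s : ℝ in 𝓝 0, 0 < s := by
    have : ∀ᶠ s : ℝ in 𝓝[>] 0, 0 < s := self_mem_nhdsWithin
    exact this.frequently.filter_mono nhdsWithin_le_nhds
  obtain ⟨s, hs, ⟨a1, b1⟩, ⟨a2, b2⟩, ⟨a3, b3⟩, a4, b4⟩ := (hnt.and_eventually hall).exists
  have key : ∀ c : ℂ, ‖c‖ = 1 →
      H (((s : ℂ) * c) • A) (((s : ℂ) * c) • A) = s ^ 2 * H (c • A) (c • A) := by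
    intro c _
    have : ((s : ℂ) * c) • A = s • (c • A) := by rw [real_smul_eq, smul_smul]
    rw [this]
    simp [pow_two, mul_assoc]
  have lin : ∀ c : ℂ, fderiv ℝ u x (((s : ℂ) * c) • A + ((s : ℂ) * c) ^ 2 • B) =
      s * fderiv ℝ u x (c • A) + s ^ 2 * fderiv ℝ u x (c ^ 2 • B) := by
    intro c
    have e1 : ((s : ℂ) * c) • A = s • (c • A) := by rw [real_smul_eq, smul_smul]
    have e2 : ((s : ℂ) * c) ^ 2 • B = (s ^ 2) • (c ^ 2 • B) := by
      rw [real_smul_eq, smul_smul]; push_cast; rw [mul_pow]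
    rw [e1, e2, map_add, ContinuousLinearMap.map_smul, ContinuousLinearMap.map_smul]
    simp
  have nrm : ∀ c : ℂ, ‖c‖ = 1 → ‖(s : ℂ) * c‖ = s := by
    intro c hc
    rw [norm_mul, hc, mul_one, Complex.norm_real, Real.norm_of_nonneg hs.le]
  rw [key 1 (by simp), lin, norm_pow, norm_norm, nrm 1 (by simp), Real.norm_eq_abs, abs_le] at a1
  rw [key (-1) (by simp), lin, norm_pow, norm_norm, nrm (-1) (by simp), Real.norm_eq_abs, abs_le]
    at a2
  rw [key Complex.I (by simp), lin, norm_pow, norm_norm, nrm Complex.I (by simp), Real.norm_eq_abs,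
    abs_le] at a3
  rw [key (-Complex.I) (by simp), lin, norm_pow, norm_norm, nrm (-Complex.I) (by simp),
    Real.norm_eq_abs, abs_le] at a4
  simp only [neg_smul, one_smul, map_neg, neg_apply, neg_neg, even_two, Even.neg_pow, one_pow,
    Complex.I_sq] at a1 a2 a3 a4 b1 b2 b3 b4
  have hsq : 0 < s ^ 2 * S := by positivity
  nlinarith [a1.1, a2.1, a3.1, a4.1]

theorem mem_iff_sgnDist_neg {E : Type*} [NormedAddCommGroup E] {Ω : Set E}
    (hΩ : IsOpen Ω) (hne : (frontier Ω).Nonempty) (z : E) : z ∈ Ω ↔ sgnDist Ω z < 0 := by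
  rw [sgnDist]
  split_ifs with hz
  · have h1 : z ∉ frontier Ω := fun h => by
      rw [hΩ.frontier_eq] at h; exact h.2 hz
    have h2 := (isClosed_frontier.notMem_iff_infDist_pos hne).1 h1
    simp [hz, h2]
  · simp only [hz, false_iff, not_lt]
    exact Metric.infDist_nonneg

/-- The Levi form of the boundary is nonnegative on complex tangential vectors. -/
theorem levi_form_nonneg {Ω : Set (Cn n)} (hΩ : IsOpen Ω) (hpsc : IsPseudoconvex Ω) {p : Cn n}
    (hp : p ∈ frontier Ω) (hreg : p ∈ regularSet Ω) {T : Cn n}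
    (hT : inner ℂ (gradient (sgnDist Ω) p) T = 0) :
    0 ≤ fderiv ℝ (fderiv ℝ (sgnDist Ω)) p T T +
      fderiv ℝ (fderiv ℝ (sgnDist Ω)) p (Complex.I • T) (Complex.I • T) := by
  obtain ⟨φ, ⟨hφs, hφp⟩, hφc⟩ := hpsc
  obtain ⟨hc, hn, -, -⟩ := hreg.self_of_nhds
  have hr0 : sgnDist Ω p = 0 := sgnDist_of_mem_frontier hp
  have hmem := mem_iff_sgnDist_neg hΩ ⟨p, hp⟩
  generalize hr : sgnDist Ω = r at hT hc hn hr0 hmem ⊢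
  set g := gradient r p with hg
  have hfd : ∀ v, fderiv ℝ r p v = (inner ℂ g v).re := fun v => by
    rw [fderiv_eq_inner_gradient, real_inner_eq_re]
  have hgg : (inner ℂ g g : ℂ) = 1 := by rw [inner_self_eq_norm_sq_to_K, hn]; simp
  have hsym := (hc.isSymmSndFDerivAt (by simp)).eq
  set H := fderiv ℝ (fderiv ℝ r) p with hH
  set S := H T T + H (Complex.I • T) (Complex.I • T) with hS
  by_contra! hneg
  have hT0 : T ≠ 0 := by
    rintro rfl
    simp [hS] at hneg
  -- This c cancels the Re(ζ²·const) part of the second order term. Along the disc r is then S|ζ|²/4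
  -- + o(|ζ|²), so for S < 0 the disc lies in Ω except at its center p.
  set c : ℂ := ⟨-(H T T - H (Complex.I • T) (Complex.I • T)) / 4, H T (Complex.I • T) / 2⟩ with hcdef
  have hexp : ∀ ζ : ℂ, fderiv ℝ r p (ζ • T + ζ ^ 2 • (c • g)) + H (ζ • T) (ζ • T) / 2 =
      S / 4 * ‖ζ‖ ^ 2 := by
    intro ζ
    have e1 : fderiv ℝ r p (ζ • T + ζ ^ 2 • (c • g)) = (ζ ^ 2 * c).re := by
      rw [hfd, inner_add_right, inner_smul_right, inner_smul_right, inner_smul_right, hT, hgg]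
      simp
    have e2 : H (ζ • T) (ζ • T) = ζ.re ^ 2 * H T T + 2 * ζ.re * ζ.im * H T (Complex.I • T) +
        ζ.im ^ 2 * H (Complex.I • T) (Complex.I • T) := by
      rw [smul_eq_re_add_im ζ T]
      simp only [map_add, add_apply, ContinuousLinearMap.map_smul, smul_apply, smul_eq_mul]
      rw [hsym (Complex.I • T) T]
      ring
    rw [e1, e2, ← Complex.normSq_eq_norm_sq, Complex.normSq_apply, hcdef, hS]
    simp [pow_two]
    ring
  have hdisc : ∀ᶠ ζ : ℂ in 𝓝 0, ζ ≠ 0 → r (p + (ζ • T + ζ ^ 2 • (c • g))) < 0 := by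
    filter_upwards [(taylor_two_disc hc T (c • g)).def (c := -S / 8) (by linarith)] with ζ hζ h0
    have hpos : 0 < ‖ζ‖ ^ 2 := by positivity
    have := hexp ζ
    rw [norm_pow, norm_norm, hr0, Real.norm_eq_abs, abs_le] at hζ
    nlinarith [hζ.2]
  have hst := (hc.hasStrictFDerivAt (by norm_num)).isLittleO.def (c := 1 / 2) (by norm_num)
  rw [nhds_prod_eq] at hst
  obtain ⟨V, hV, hVst⟩ := eventually_prod_self_iff'.1 hst
  obtain ⟨δ, hδ, hball⟩ := Metric.mem_nhds_iff.1 hV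
  -- Translating inward by tg lowers r by at least t/2, uniformly near p, so each translated disc
  -- with t > 0 lies entirely in Ω.
  have hdecr : ∀ x ∈ Metric.ball p (δ / 2), ∀ t : ℝ, 0 < t → t < δ / 2 → r (x - t • g) < r x := by
    intro x hx t ht0 ht
    have hx' : x ∈ V := hball (Metric.ball_subset_ball (by linarith) hx)
    have hxt : x - t • g ∈ V := by
      apply hball
      rw [Metric.mem_ball, dist_eq_norm] at hx ⊢
      calc ‖x - t • g - p‖ = ‖(x - p) - t • g‖ := by congr 1; abel
        _ ≤ ‖x - p‖ + ‖t • g‖ := norm_sub_le _ _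
        _ < δ := by rw [norm_smul, hn, Real.norm_of_nonneg ht0.le]; linarith
    have := hVst x hx' _ hxt
    simp only [sub_sub_cancel, ContinuousLinearMap.map_smul] at this
    rw [norm_smul, hn, Real.norm_of_nonneg ht0.le, hfd, hgg, Real.norm_eq_abs, abs_le] at this
    simp only [Complex.one_re, smul_eq_mul] at this
    linarith [this.1]
  have hcont : Continuous fun ζ : ℂ => p + (ζ • T + ζ ^ 2 • (c • g)) := by fun_prop
  have hnear : ∀ᶠ ζ : ℂ in 𝓝 0, p + (ζ • T + ζ ^ 2 • (c • g)) ∈ Metric.ball p (δ / 2) := by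
    refine (hcont.tendsto 0).eventually (Metric.isOpen_ball.mem_nhds ?_)
    simpa using half_pos hδ
  obtain ⟨ε', hε', hb'⟩ := Metric.eventually_nhds_iff_ball.1 (hdisc.and hnear)
  obtain ⟨ε, hε, hεε'⟩ := exists_between hε'
  have hb : ∀ ζ ∈ Metric.closedBall (0 : ℂ) ε,
      (ζ ≠ 0 → r (p + (ζ • T + ζ ^ 2 • (c • g))) < 0) ∧
        p + (ζ • T + ζ ^ 2 • (c • g)) ∈ Metric.ball p (δ / 2) :=
    fun ζ hζ => hb' ζ (Metric.closedBall_subset_ball hεε' hζ)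
  have hin : ∀ ζ ∈ Metric.closedBall (0 : ℂ) ε, ∀ t : ℝ, 0 ≤ t → t ≤ δ / 4 → (t = 0 → ζ ≠ 0) →
      p + (ζ • T + ζ ^ 2 • (c • g)) - t • g ∈ Ω := by
    intro ζ hζ t ht0 ht htζ
    rw [hmem]
    rcases ht0.eq_or_lt with rfl | ht0
    · simpa using (hb ζ hζ).1 (htζ rfl)
    · refine (hdecr _ (hb ζ hζ).2 t ht0 (by linarith)).trans_le ?_
      by_cases h0 : ζ = 0
      · simp [h0, hr0]
      · exact ((hb ζ hζ).1 h0).le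
  have hφcont : ContinuousOn φ Ω := hφs.continuousOn
  -- The rims of all translated discs, including t = 0, form a compact subset of Ω on which φ ≤ M.
  -- By the maximum principle φ(p - tg) ≤ M, and compactness of the sublevel set then places p in Ω
  -- as t → 0.
  have hKc : IsCompact ((fun y : ℂ × ℝ => p + (y.1 • T + y.1 ^ 2 • (c • g)) - y.2 • g) ''
      (Metric.sphere 0 ε ×ˢ Icc 0 (δ / 4))) :=
    ((isCompact_sphere 0 ε).prod isCompact_Icc).image (by fun_prop)
  obtain ⟨M, hM⟩ := hKc.bddAbove_image (f := φ) (hφcont.mono (by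
    rintro _ ⟨⟨ζ, t⟩, ⟨hζ, ht⟩, rfl⟩
    refine hin ζ (Metric.sphere_subset_closedBall hζ) t ht.1 ht.2 fun _ h0 => ?_
    simp only [h0, mem_sphere_iff_norm, sub_self, norm_zero] at hζ
    exact hε.ne hζ))
  have hsub : ∀ t : ℝ, 0 < t → t ≤ δ / 4 → p - t • g ∈ {z ∈ Ω | φ z ≤ M} := by
    intro t ht0 ht
    have hinΩ : ∀ ζ ∈ Metric.closedBall (0 : ℂ) ε, p + (ζ • T + ζ ^ 2 • (c • g)) - t • g ∈ Ω :=
      fun ζ hζ => hin ζ hζ t ht0.le ht fun h => absurd h ht0.ne'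
    have h00 : (0 : ℂ) ∈ Metric.closedBall (0 : ℂ) ε := by simp [hε.le]
    obtain ⟨ζ₀, hζ₀, hmax⟩ := (isCompact_closedBall (0 : ℂ) ε).exists_isMaxOn ⟨0, h00⟩
      (f := fun ζ => φ (p + (ζ • T + ζ ^ 2 • (c • g)) - t • g))
      (hφcont.comp (by fun_prop) hinΩ)
    have hle : φ (p - t • g) ≤ φ (p + (ζ₀ • T + ζ₀ ^ 2 • (c • g)) - t • g) := by
      have := hmax h00
      simpa using this
    refine ⟨by simpa using hinΩ 0 h00, hle.trans ?_⟩
    rcases (mem_closedBall_zero_iff.1 hζ₀).eq_or_lt with heq | hlt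
    · refine hM ⟨_, ⟨(ζ₀, t), ⟨by simpa using heq, ht0.le, ht⟩, rfl⟩, rfl⟩
    exfalso
    set x := p + (ζ₀ • T + ζ₀ ^ 2 • (c • g)) - t • g with hx
    have hxΩ : x ∈ Ω := hinΩ ζ₀ hζ₀
    have hφx : ContDiffAt ℝ 2 φ x :=
      (hφs.contDiffAt (hΩ.mem_nhds hxΩ)).of_le (WithTop.coe_le_coe.2 le_top)
    -- This is the velocity of the disc at an interior maximum ζ₀. Strict plurisubharmonicity
    -- contradicts the maximum only in a nonzero direction.
    have hne : T + (2 * ζ₀ * c) • g ≠ 0 := by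
      intro h0
      have h1 := congrArg (fun v => inner ℂ g v) h0
      simp only [inner_add_right, inner_smul_right, hT, hgg, zero_add, mul_one,
        inner_zero_right] at h1
      rw [h1, zero_smul, add_zero] at h0
      exact hT0 h0
    have hpos := hφp x hxΩ _ hne
    rw [levi_self_re hφx] at hpos
    have := hessian_nonpos_of_disc_max hφx (T + (2 * ζ₀ * c) • g) (c • g) (by
      have hev : ∀ᶠ ζ : ℂ in 𝓝 0, ζ₀ + ζ ∈ Metric.closedBall (0 : ℂ) ε := by
        have hc0 : Continuous fun ζ : ℂ => ζ₀ + ζ := by fun_prop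
        refine (hc0.tendsto 0).eventually ?_
        rw [add_zero]
        exact Filter.mem_of_superset (Metric.isOpen_ball.mem_nhds
          (mem_ball_zero_iff.2 hlt)) Metric.ball_subset_closedBall
      filter_upwards [hev] with ζ hζ
      have h1 := hmax hζ
      have h2 : p + ((ζ₀ + ζ) • T + (ζ₀ + ζ) ^ 2 • (c • g)) - t • g =
          x + (ζ • (T + (2 * ζ₀ * c) • g) + ζ ^ 2 • (c • g)) := by
        rw [hx]
        module
      simp only [mem_ofPred_eq, h2] at h1
      exact h1)
    linarith
  have hclosed := (hφc M).isClosed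
  have hlim : Tendsto (fun t : ℝ => p - t • g) (𝓝[>] 0) (𝓝 p) := by
    have hc0 : Continuous fun t : ℝ => p - t • g := by fun_prop
    have := (hc0.tendsto 0).mono_left (nhdsWithin_le_nhds (s := Ioi 0))
    simpa using this
  have hpin := hclosed.mem_of_tendsto hlim (by
    have h4 : Ioc (0 : ℝ) (δ / 4) ∈ 𝓝[>] (0 : ℝ) := Ioc_mem_nhdsGT (by linarith)
    filter_upwards [h4] with t ht using hsub t ht.1 ht.2)
  rw [hΩ.frontier_eq] at hp
  exact hp.2 hpin.1

end Pseudoconvexity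

/-! ### The quadratic estimate near the boundary. -/

section BoundaryEstimate

variable {n : ℕ}

/-- A quarter of the `J`-average of the quadratic form of `H`. -/
def leviForm (H : Cn n →L[ℝ] Cn n) (v : Cn n) : ℝ :=
  (inner ℝ v (H v) + inner ℝ (Complex.I • v) (H (Complex.I • v))) / 4

/-- The pairing of `g` with the complex-linear part of `H`. -/
def alphaForm (g : Cn n) (H : Cn n →L[ℝ] Cn n) (v : Cn n) : ℂ :=
  (1 / 2) * (inner ℂ g (H v) - Complex.I * inner ℂ g (H (Complex.I • v)))

theorem alphaForm_eq (g : Cn n) (H : Cn n →L[ℝ] Cn n) (v : Cn n) :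
    alphaForm g H v = inner ℂ g (clinPart H v) := by
  rw [alphaForm, clinPart_apply, inner_smul_right, inner_sub_right, inner_smul_right]

theorem leviForm_eq (H : Cn n →L[ℝ] Cn n) (v : Cn n) :
    leviForm H v = (inner ℂ v (clinPart H v)).re / 2 := by
  rw [leviForm, inner_clinPart_self_re]
  ring

theorem inner_I_smul_left (v w : Cn n) : (inner ℂ (Complex.I • v) w).re = (inner ℂ v w).im := by
  rw [inner_smul_left]
  simp

theorem inner_clinPart_re (H : Cn n →L[ℝ] Cn n) (v w : Cn n) :
    (inner ℂ v (clinPart H w)).re =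
      (inner ℝ v (H w) + inner ℝ (Complex.I • v) (H (Complex.I • w))) / 2 := by
  rw [real_inner_eq_re, real_inner_eq_re, inner_I_smul_left, ← alphaForm_eq, alphaForm]
  simp
  ring

/-- The complex-linear part of a symmetric real map is Hermitian: the real parts agree by symmetry,
and the imaginary parts follow on replacing a vector by its multiple by i. -/
theorem inner_clinPart_conj {H : Cn n →L[ℝ] Cn n}
    (hH : ∀ v w, (inner ℝ (H v) w : ℝ) = inner ℝ (H w) v) (v w : Cn n) :
    (inner ℂ v (clinPart H w) : ℂ) = (starRingEnd ℂ) (inner ℂ w (clinPart H v)) := by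
  have hre : ∀ v w, (inner ℂ v (clinPart H w)).re = (inner ℂ w (clinPart H v)).re := by
    intro v w
    rw [inner_clinPart_re, inner_clinPart_re, real_inner_comm, hH, real_inner_comm,
      real_inner_comm (H (Complex.I • w)), hH (Complex.I • w),
      real_inner_comm (H (Complex.I • v)) (Complex.I • w)]
  refine Complex.ext ?_ ?_
  · rw [hre, Complex.conj_re]
  · rw [Complex.conj_im, ← inner_I_smul_left, hre, map_smul, inner_smul_right]
    simp

/-- Polarization of the Hermitian form. The vector subtracted is the complex normal part of τ, of
size t, so after division by t the cross term stays finite and brings in α. -/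
theorem leviForm_sub_smul {H : Cn n →L[ℝ] Cn n}
    (hH : ∀ v w, (inner ℝ (H v) w : ℝ) = inner ℝ (H w) v) (g τ : Cn n) (t : ℝ) (σ : ℂ) :
    leviForm H τ = leviForm H (τ - (2 * t * σ) • g) +
      t * (2 * ((starRingEnd ℂ) σ * alphaForm g H τ).re - 4 * t * ‖σ‖ ^ 2 * leviForm H g) := by
  rw [leviForm_eq, leviForm_eq, leviForm_eq, alphaForm_eq, map_sub, map_smul, inner_sub_left,
    inner_sub_right, inner_sub_right, inner_smul_left, inner_smul_left, inner_smul_right,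
    inner_smul_right, inner_clinPart_conj hH τ g, ← Complex.normSq_eq_norm_sq, Complex.normSq_apply]
  have him : (inner ℂ g (clinPart H g)).im = 0 := by
    have := congrArg Complex.im (inner_clinPart_conj hH g g)
    rw [Complex.conj_im] at this
    linarith
  generalize (inner ℂ g (clinPart H τ) : ℂ) = w
  simp [him]
  ring

theorem leviForm_smul (H : Cn n →L[ℝ] Cn n) (a : ℝ) (v : Cn n) :
    leviForm H (a • v) = a ^ 2 * leviForm H v := by
  rw [leviForm, leviForm, smul_comm Complex.I a v]
  simp only [map_smul, inner_smul_left, inner_smul_right]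
  simp
  ring

/-- On vectors null for a semidefinite Levi form, the form vanishes against all tangent vectors. -/
theorem inner_clinPart_eq_zero_of_null {H : Cn n →L[ℝ] Cn n}
    (hH : ∀ v w, (inner ℝ (H v) w : ℝ) = inner ℝ (H w) v) {g : Cn n}
    (hpos : ∀ T, (inner ℂ g T : ℂ) = 0 → 0 ≤ leviForm H T) {τ : Cn n}
    (hτ : (inner ℂ g τ : ℂ) = 0) (h0 : leviForm H τ = 0) {θ : Cn n}
    (hθ : (inner ℂ g θ : ℂ) = 0) : (inner ℂ θ (clinPart H τ) : ℂ) = 0 := by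
  have key : ∀ θ, (inner ℂ g θ : ℂ) = 0 → (inner ℂ θ (clinPart H τ)).re = 0 := by
    intro θ hθ
    have hx : ∀ x : ℝ, 0 ≤ x * (inner ℂ θ (clinPart H τ)).re + x ^ 2 * leviForm H θ := by
      intro x
      have h1 := hpos (τ + (x : ℂ) • θ) (by rw [inner_add_right, inner_smul_right, hτ, hθ]; simp)
      have h2 : leviForm H (τ + (x : ℂ) • θ) =
          leviForm H τ + x * (inner ℂ θ (clinPart H τ)).re + x ^ 2 * leviForm H θ := by
        simp only [leviForm_eq, map_add, map_smul, inner_add_left, inner_add_right, inner_smul_left,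
          inner_smul_right]
        rw [inner_clinPart_conj hH τ θ]
        generalize (inner ℂ θ (clinPart H τ) : ℂ) = w
        simp
        ring
      rw [h2, h0, zero_add] at h1
      exact h1
    by_contra hne
    set a := (inner ℂ θ (clinPart H τ)).re
    set b := leviForm H θ
    have hb : 0 ≤ b := hpos θ hθ
    -- The quadratic takes the value -a²/(b+1)² here. The +1 covers b = 0.
    have h3 := hx (-a / (b + 1))
    have h4 : -a / (b + 1) * a + (-a / (b + 1)) ^ 2 * b = -(a ^ 2 / (b + 1) ^ 2) := by
      field_simp
      ring
    rw [h4] at h3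
    have : 0 < a ^ 2 / (b + 1) ^ 2 := by positivity
    linarith
  refine Complex.ext (key θ hθ) ?_
  rw [← inner_I_smul_left, key _ (by rw [inner_smul_right, hθ, mul_zero])]
  simp

/-- The remainder in the boundary estimate. -/
def remainder (η K t : ℝ) (g z : Cn n) (Hp Hz : Cn n →L[ℝ] Cn n) (τ : Cn n) (σ : ℂ) : ℝ :=
  (inner ℝ (Hp τ) (Hz τ) + inner ℝ (Hp (Complex.I • τ)) (Hz (Complex.I • τ))) / 4 +
    (2 * ((starRingEnd ℂ) σ * alphaForm g Hp τ).re - 4 * t * ‖σ‖ ^ 2 * leviForm Hp g) +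
    ‖σ‖ ^ 2 + K * ‖τ‖ ^ 2 - η * ‖σ + K * inner ℂ z τ‖ ^ 2

theorem continuous_remainder (η K : ℝ) :
    Continuous fun x : ℝ × Cn n × Cn n × (Cn n →L[ℝ] Cn n) × (Cn n →L[ℝ] Cn n) × Cn n × ℂ =>
      remainder η K x.1 x.2.1 x.2.2.1 x.2.2.2.1 x.2.2.2.2.1 x.2.2.2.2.2.1 x.2.2.2.2.2.2 := by
  unfold remainder alphaForm leviForm
  fun_prop

theorem continuous_leviForm :
    Continuous fun x : (Cn n →L[ℝ] Cn n) × Cn n => leviForm x.1 x.2 := by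
  unfold leviForm
  fun_prop

/-- Completing the square after multiplication by 1 - η; the hypothesis on B is the discriminant
condition. -/
theorem sq_add_sq_pos_of_lt {η K B X y : ℝ} (hη1 : η < 1)
    (hB : η * B ^ 2 < (1 - η) * K) (hXy : X ≠ 0 ∨ y ≠ 0) :
    0 < X ^ 2 + K * y ^ 2 - η * (X + B * y) ^ 2 := by
  have h1 : (1 - η) * (X ^ 2 + K * y ^ 2 - η * (X + B * y) ^ 2) =
      ((1 - η) * X - η * B * y) ^ 2 + ((1 - η) * K - η * B ^ 2) * y ^ 2 := by ring
  have h2 : 0 < (1 - η) * (X ^ 2 + K * y ^ 2 - η * (X + B * y) ^ 2) := by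
    rw [h1]
    by_cases hy : y = 0
    · subst hy
      have hX : X ≠ 0 := by simpa using hXy
      have : 0 < (1 - η) * X ∨ (1 - η) * X < 0 := by
        rcases lt_or_gt_of_ne hX with h | h
        · right; nlinarith
        · left; nlinarith
      have h3 : (1 - η) * X ≠ 0 := by rcases this with h | h <;> [exact h.ne'; exact h.ne]
      have : 0 < ((1 - η) * X) ^ 2 := by positivity
      simpa using this
    · have h3 : 0 < ((1 - η) * K - η * B ^ 2) * y ^ 2 := by
        have : 0 < (1 - η) * K - η * B ^ 2 := by linarith
        positivity
      nlinarith [sq_nonneg ((1 - η) * X - η * B * y)]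
  exact pos_of_mul_pos_right h2 (by linarith)

/-- The quadratic term in Hτ dominates |c|², which completes 2 Re(σ̄c) + |σ|² to |σ+c|². What is
left is a binary form in |σ+c| and |τ|. -/
theorem remainder_pos {η K A R : ℝ} {g p : Cn n} {H : Cn n →L[ℝ] Cn n} {τ : Cn n} {σ : ℂ}
    (hη : 0 < η) (hη1 : η < 1) (hK : 0 ≤ K)
    (hlt : η * (A + K * R) ^ 2 < (1 - η) * K) (hg : ‖g‖ = 1)
    (hgH : ∀ v, (inner ℝ g (H v) : ℝ) = 0) (hα : ‖alphaForm g H τ‖ ≤ A * ‖τ‖) (hp : ‖p‖ ≤ R)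
    (hne : τ ≠ 0 ∨ σ ≠ 0) : 0 < remainder η K 0 g p H H τ σ := by
  set c := alphaForm g H τ with hc
  -- Since ⟨g, Hv⟩ is purely imaginary, its values at τ and iτ give the imaginary and real parts of
  -- 2c. Hence |c|² is a quarter of a sum of squares, with no loss from a triangle inequality.
  have hcs : ‖c‖ ^ 2 ≤ (inner ℝ (H τ) (H τ) + inner ℝ (H (Complex.I • τ)) (H (Complex.I • τ))) / 4 := by
    have e1 : ∀ v, (inner ℂ g v).re = 0 → (inner ℂ g v).im ^ 2 ≤ inner ℝ v v := by
      intro v hv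
      have h1 := norm_inner_le_norm (𝕜 := ℂ) g v
      rw [hg, one_mul] at h1
      have h2 := Complex.abs_im_le_norm (inner ℂ g v)
      rw [real_inner_self_eq_norm_sq, ← sq_abs]
      gcongr
      exact h2.trans h1
    have r1 : (inner ℂ g (H τ)).re = 0 := by rw [← real_inner_eq_re, hgH]
    have r2 : (inner ℂ g (H (Complex.I • τ))).re = 0 := by rw [← real_inner_eq_re, hgH]
    have i1 := e1 _ r1
    have i2 := e1 _ r2
    have : ‖c‖ ^ 2 = ((inner ℂ g (H τ)).im ^ 2 + (inner ℂ g (H (Complex.I • τ))).im ^ 2) / 4 := by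
      rw [← Complex.normSq_eq_norm_sq, Complex.normSq_apply, hc, alphaForm]
      simp [r1, r2]
      ring
    rw [this]
    linarith
  have hX : ‖c‖ ^ 2 + 2 * ((starRingEnd ℂ) σ * c).re + ‖σ‖ ^ 2 = ‖σ + c‖ ^ 2 := by
    simp only [← Complex.normSq_eq_norm_sq, Complex.normSq_apply]
    simp
    ring
  have hin : ‖(inner ℂ p τ : ℂ)‖ ≤ R * ‖τ‖ :=
    (norm_inner_le_norm p τ).trans (by gcongr)
  have hle : ‖σ + K * inner ℂ p τ‖ ≤ ‖σ + c‖ + (A + K * R) * ‖τ‖ := by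
    calc ‖σ + K * inner ℂ p τ‖ = ‖(σ + c) - c + K * inner ℂ p τ‖ := by congr 1; ring
      _ ≤ ‖σ + c‖ + ‖c‖ + ‖(K : ℂ) * inner ℂ p τ‖ :=
        (norm_add_le _ _).trans (by gcongr; exact norm_sub_le _ _)
      _ ≤ ‖σ + c‖ + A * ‖τ‖ + K * (R * ‖τ‖) := by
        rw [norm_mul, Complex.norm_real, Real.norm_of_nonneg hK]
        gcongr
      _ = _ := by ring
  have hpos := sq_add_sq_pos_of_lt (X := ‖σ + c‖) (y := ‖τ‖) hη1 hlt (by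
    by_cases hτ : τ = 0
    · left
      have hσ : σ ≠ 0 := by simpa [hτ] using hne
      have hc0 : c = 0 := by simpa [hτ] using hα
      simpa [hc0] using hσ
    · right
      simpa using hτ)
  have hle2 : η * ‖σ + K * inner ℂ p τ‖ ^ 2 ≤ η * (‖σ + c‖ + (A + K * R) * ‖τ‖) ^ 2 := by gcongr
  unfold remainder
  rw [← hc]
  linarith

/-- The Riccati relation moves the Hessian from z to the foot point, and the splitting of τ then
isolates the only term still divided by t. All other terms are continuous up to t = 0. -/
theorem leviForm_div_add_eq {η K t : ℝ} (ht : t ≠ 0) {Hp Hz : Cn n →L[ℝ] Cn n}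
    (hsymm : ∀ v w, (inner ℝ (Hp v) w : ℝ) = inner ℝ (Hp w) v)
    (hH : ∀ v, Hz v = Hp v + t • Hp (Hz v)) (g z τ : Cn n) (σ : ℂ) :
    leviForm Hz τ / t + ‖σ‖ ^ 2 + K * ‖τ‖ ^ 2 - η * ‖σ + K * inner ℂ z τ‖ ^ 2 =
      leviForm Hp (τ - (2 * t * σ) • g) / t + remainder η K t g z Hp Hz τ σ := by
  have e : ∀ v, (inner ℝ v (Hz v) : ℝ) = inner ℝ v (Hp v) + t * inner ℝ (Hp v) (Hz v) := by
    intro v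
    have h1 : (inner ℝ v (Hp (Hz v)) : ℝ) = inner ℝ (Hp v) (Hz v) := by
      rw [real_inner_comm, hsymm]
    conv_lhs => rw [hH v]
    rw [inner_add_right, real_inner_smul_right, h1]
  have h2 : leviForm Hz τ = leviForm Hp τ + t * ((inner ℝ (Hp τ) (Hz τ) +
      inner ℝ (Hp (Complex.I • τ)) (Hz (Complex.I • τ))) / 4) := by
    rw [leviForm, leviForm, e, e]
    ring
  rw [h2, leviForm_sub_smul hsymm g τ t σ, add_div, add_div, mul_div_cancel_left₀ _ ht,
    mul_div_cancel_left₀ _ ht, remainder]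
  ring

theorem tendsto_remainder {ι : Type*} {l : Filter ι} (η K : ℝ) {t : ι → ℝ} {g z τ : ι → Cn n}
    {Hp Hz : ι → Cn n →L[ℝ] Cn n} {σ : ι → ℂ} {t' : ℝ} {g' z' τ' : Cn n}
    {Hp' Hz' : Cn n →L[ℝ] Cn n} {σ' : ℂ} (ht : Tendsto t l (𝓝 t')) (hg : Tendsto g l (𝓝 g'))
    (hz : Tendsto z l (𝓝 z')) (hHp : Tendsto Hp l (𝓝 Hp')) (hHz : Tendsto Hz l (𝓝 Hz'))
    (hτ : Tendsto τ l (𝓝 τ')) (hσ : Tendsto σ l (𝓝 σ')) :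
    Tendsto (fun i => remainder η K (t i) (g i) (z i) (Hp i) (Hz i) (τ i) (σ i)) l
      (𝓝 (remainder η K t' g' z' Hp' Hz' τ' σ')) := by
  have h1 := ht.prodMk_nhds (hg.prodMk_nhds (hz.prodMk_nhds (hHp.prodMk_nhds
      (hHz.prodMk_nhds (hτ.prodMk_nhds hσ)))))
  have h2 := (continuous_remainder (n := n) η K).tendsto (t', g', z', Hp', Hz', τ', σ')
  have h3 := h2.comp h1
  exact h3

theorem tendsto_leviForm {ι : Type*} {l : Filter ι} {H : ι → Cn n →L[ℝ] Cn n} {τ : ι → Cn n}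
    {H' : Cn n →L[ℝ] Cn n} {τ' : Cn n} (hH : Tendsto H l (𝓝 H')) (hτ : Tendsto τ l (𝓝 τ')) :
    Tendsto (fun i => leviForm (H i) (τ i)) l (𝓝 (leviForm H' τ')) := by
  have h1 := hH.prodMk_nhds hτ
  have h2 := (continuous_leviForm (n := n)).tendsto (H', τ')
  have h3 := h2.comp h1
  exact h3

set_option maxHeartbeats 1000000 in
/-- The estimate near the boundary from which plurisubharmonicity follows. -/
theorem exists_boundary_estimate {Ω : Set (Cn n)} (hΩ : IsOpen Ω) (hbdd : Bornology.IsBounded Ω)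
    (hpsc : IsPseudoconvex Ω) (hfr : frontier Ω ⊆ regularSet Ω) (hne : (frontier Ω).Nonempty)
    {η K A R : ℝ} (hη : 0 < η) (hη1 : η < 1) (hK : 0 ≤ K)
    (hlt : η * (A + K * R) ^ 2 < (1 - η) * K) (hR : ∀ p ∈ frontier Ω, ‖p‖ ≤ R)
    (hA : ∀ p ∈ frontier Ω, ∀ τ ∈ leviNull Ω p,
      ‖alphaForm (gradient (sgnDist Ω) p) (fderiv ℝ (gradient (sgnDist Ω)) p) τ‖ ≤ A * ‖τ‖) :
    ∃ ε > 0, ∀ z ∈ Ω, Metric.infDist z (frontier Ω) < ε → z ∈ regularSet Ω ∧ ∀ τ : Cn n,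
      η * ‖del (sgnDist Ω) z τ / (-sgnDist Ω z : ℝ) + K * inner ℂ z τ‖ ^ 2 ≤
        (levi (sgnDist Ω) z τ τ).re / (-sgnDist Ω z) +
          ‖del (sgnDist Ω) z τ / (-sgnDist Ω z : ℝ)‖ ^ 2 + K * ‖τ‖ ^ 2 := by
  have hcl : IsCompact (closure Ω) := hbdd.isCompact_closure
  have hfc : IsCompact (frontier Ω) := hcl.of_isClosed_subset isClosed_frontier frontier_subset_closure
  obtain ⟨ε₀, hε₀, hth⟩ := hfc.exists_thickening_subset_open (isOpen_regularSet Ω) hfr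
  have hreg : ∀ z, Metric.infDist z (frontier Ω) < ε₀ → z ∈ regularSet Ω := fun z hz =>
    hth ((Metric.mem_thickening_iff_infDist_lt hne).2 hz)
  have hmem := mem_iff_sgnDist_neg hΩ hne
  generalize hr : sgnDist Ω = r at *
  have hC2 : ∀ z ∈ regularSet Ω, ContDiffAt ℝ 2 r z := fun z hz => by
    have := hz.self_of_nhds.1
    rwa [hr] at this
  have hsymm : ∀ z ∈ regularSet Ω, ∀ v w : Cn n,
      (inner ℝ (fderiv ℝ (gradient r) z v) w : ℝ) = inner ℝ (fderiv ℝ (gradient r) z w) v :=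
    fun z hz => inner_fderiv_gradient_comm (hC2 z hz)
  have hlevi : ∀ z ∈ regularSet Ω, ∀ τ, (levi r z τ τ).re = leviForm (fderiv ℝ (gradient r) z) τ := by
    intro z hz τ
    rw [levi_self_re (hC2 z hz), leviForm, real_inner_comm, inner_fderiv_gradient (hC2 z hz),
      real_inner_comm, inner_fderiv_gradient (hC2 z hz)]
  have hdel : ∀ z ∈ regularSet Ω, ∀ τ, del r z τ = (1 / 2) * inner ℂ (gradient r z) τ :=
    fun z hz τ => del_eq_inner ((hC2 z hz).differentiableAt (by norm_num)) τ
  have hlevipos : ∀ p ∈ frontier Ω, ∀ T, (inner ℂ (gradient r p) T : ℂ) = 0 →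
      0 ≤ leviForm (fderiv ℝ (gradient r) p) T := by
    intro p hp T hT
    have := levi_form_nonneg hΩ hpsc hp (hfr hp) (T := T) (by rw [hr]; exact hT)
    rw [hr] at this
    rw [leviForm, real_inner_comm, inner_fderiv_gradient (hC2 p (hfr hp)),
      real_inner_comm, inner_fderiv_gradient (hC2 p (hfr hp))]
    linarith
  -- Here σ is a separate variable tied to τ by a linear relation that does not divide by r. It can
  -- stay nonzero in the limit even though ∂r(τ) tends to 0.
  have hbound : ∃ ε > 0, ε ≤ ε₀ ∧ ∀ z ∈ Ω, Metric.infDist z (frontier Ω) < ε →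
      ∀ (τ : Cn n) (σ : ℂ), (1 / 2) * inner ℂ (gradient r z) τ = (-r z : ℝ) * σ →
        η * ‖σ + K * inner ℂ z τ‖ ^ 2 ≤
          leviForm (fderiv ℝ (gradient r) z) τ / (-r z) + ‖σ‖ ^ 2 + K * ‖τ‖ ^ 2 := by
    by_contra! hcon
    -- Both sides are homogeneous of degree two in (τ, σ), so counterexamples can be scaled to the
    -- unit sphere.
    have hseq : ∀ k : ℕ, ∃ (z τ : Cn n) (σ : ℂ), z ∈ Ω ∧
        Metric.infDist z (frontier Ω) < min ε₀ (1 / (k + 1)) ∧ ‖(τ, σ)‖ = 1 ∧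
        (1 / 2) * inner ℂ (gradient r z) τ = (-r z : ℝ) * σ ∧
        leviForm (fderiv ℝ (gradient r) z) τ / (-r z) + ‖σ‖ ^ 2 + K * ‖τ‖ ^ 2 <
          η * ‖σ + K * inner ℂ z τ‖ ^ 2 := by
      intro k
      obtain ⟨z, hz, hd, τ, σ, h1, h2⟩ := hcon (min ε₀ (1 / (k + 1)))
        (lt_min hε₀ (by positivity)) (min_le_left _ _)
      have hN : 0 < ‖(τ, σ)‖ := by
        rw [norm_pos_iff]
        intro h0
        obtain ⟨rfl, rfl⟩ := Prod.mk_eq_zero.1 h0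
        simp [leviForm] at h2
      set a := ‖(τ, σ)‖⁻¹ with ha
      have ha0 : 0 < a := by positivity
      refine ⟨z, a • τ, a • σ, hz, hd, ?_, ?_, ?_⟩
      · rw [← Prod.smul_mk, norm_smul, Real.norm_of_nonneg ha0.le, ha, inv_mul_cancel₀ hN.ne']
      · rw [real_smul_eq, inner_smul_right, Complex.real_smul]
        linear_combination (a : ℂ) * h1
      · have e1 : a • σ + K * inner ℂ z (a • τ) = a • (σ + K * inner ℂ z τ) := by
          rw [real_smul_eq, inner_smul_right, Complex.real_smul, Complex.real_smul]
          ring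
        rw [e1, leviForm_smul, norm_smul, norm_smul, norm_smul, Real.norm_of_nonneg ha0.le]
        have := mul_lt_mul_of_pos_left h2 (pow_pos ha0 2)
        calc _ = a ^ 2 * (leviForm (fderiv ℝ (gradient r) z) τ / (-r z) + ‖σ‖ ^ 2 + K * ‖τ‖ ^ 2) := by
              ring
          _ < _ := this
          _ = _ := by ring
    choose z τ σ hz hd hnorm htan hneg using hseq
    have hcomp : IsCompact (closure Ω ×ˢ Metric.sphere (0 : Cn n × ℂ) 1) :=
      hcl.prod (isCompact_sphere 0 1)
    obtain ⟨⟨p, τ', σ'⟩, hp', κ, hκ, hlim⟩ := hcomp.tendsto_subseq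
      (x := fun k => (z k, (τ k, σ k))) (fun k => ⟨subset_closure (hz k), by simp [hnorm k]⟩)
    have hzl : Tendsto (fun k => z (κ k)) atTop (𝓝 p) := (continuous_fst.tendsto _).comp hlim
    have hτl : Tendsto (fun k => τ (κ k)) atTop (𝓝 τ') :=
      ((continuous_fst.comp continuous_snd).tendsto _).comp hlim
    have hσl : Tendsto (fun k => σ (κ k)) atTop (𝓝 σ') :=
      ((continuous_snd.comp continuous_snd).tendsto _).comp hlim
    have hpfr : p ∈ frontier Ω := by
      rw [isClosed_frontier.mem_iff_infDist_zero hne]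
      have h1 : Tendsto (fun k => Metric.infDist (z (κ k)) (frontier Ω)) atTop
          (𝓝 (Metric.infDist p (frontier Ω))) :=
        ((Metric.continuous_infDist_pt _).tendsto p).comp hzl
      have h2 : Tendsto (fun k => Metric.infDist (z (κ k)) (frontier Ω)) atTop (𝓝 0) := by
        refine squeeze_zero (fun _ => Metric.infDist_nonneg)
          (fun k => ((hd (κ k)).trans_le (min_le_right _ _)).le) ?_
        exact tendsto_one_div_add_atTop_nhds_zero_nat.comp hκ.tendsto_atTop
      exact tendsto_nhds_unique h1 h2
    have hpr := hfr hpfr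
    have hzreg : ∀ k, z k ∈ regularSet Ω := fun k => hreg _ ((hd k).trans_le (min_le_left _ _))
    have hrc : ContinuousAt r p := (hC2 p hpr).continuousAt
    have hgc1 : ContDiffAt ℝ 1 (gradient r) p := contDiffAt_gradient (hC2 p hpr)
    have hgc : ContinuousAt (gradient r) p := hgc1.continuousAt
    have hHc : ContinuousAt (fderiv ℝ (gradient r)) p :=
      (hgc1.fderiv_right (m := 0) (by norm_num)).continuousAt
    have hr0 : r p = 0 := by rw [← hr]; exact sgnDist_of_mem_frontier hpfr
    have hrl : Tendsto (fun k => r (z (κ k))) atTop (𝓝 0) := by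
      have := hrc.tendsto.comp hzl
      rwa [hr0] at this
    have hgl : Tendsto (fun k => gradient r (z (κ k))) atTop (𝓝 (gradient r p)) :=
      hgc.tendsto.comp hzl
    have hHl : Tendsto (fun k => fderiv ℝ (gradient r) (z (κ k))) atTop
        (𝓝 (fderiv ℝ (gradient r) p)) := hHc.tendsto.comp hzl
    let q : ℕ → Cn n := fun k => z k - r (z k) • gradient r (z k)
    have hql : Tendsto (fun k => q (κ k)) atTop (𝓝 p) := by
      have := hzl.sub (hrl.smul hgl)
      simpa using this
    have hqfr : ∀ k, q k ∈ frontier Ω ∧ gradient r (q k) = gradient r (z k) ∧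
        ‖gradient r (z k)‖ = 1 ∧ ∀ v, fderiv ℝ (gradient r) (z k) v = fderiv ℝ (gradient r) (q k) v -
          r (z k) • fderiv ℝ (gradient r) (q k) (fderiv ℝ (gradient r) (z k) v) := by
      intro k
      have h1 := (hzreg k).self_of_nhds
      have h2 := hessian_sgnDist_eq (hzreg k) hfr
      rw [hr] at h1 h2
      exact ⟨h1.2.2.1, h1.2.2.2, h1.2.1, h2⟩
    have hHql : Tendsto (fun k => fderiv ℝ (gradient r) (q (κ k))) atTop
        (𝓝 (fderiv ℝ (gradient r) p)) := hHc.tendsto.comp hql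
    -- decomposition of the form at `z k`
    have hdec : ∀ k, 0 < -r (z k) ∧
        0 ≤ leviForm (fderiv ℝ (gradient r) (q k))
          (τ k - (2 * (-r (z k) : ℝ) * σ k) • gradient r (z k)) ∧
        leviForm (fderiv ℝ (gradient r) (q k))
          (τ k - (2 * (-r (z k) : ℝ) * σ k) • gradient r (z k)) / (-r (z k)) +
          remainder η K (-r (z k)) (gradient r (z k)) (z k) (fderiv ℝ (gradient r) (q k))
            (fderiv ℝ (gradient r) (z k)) (τ k) (σ k) < 0 := by
      intro k
      obtain ⟨hq1, hq2, hg1, hHeq⟩ := hqfr k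
      have ht : 0 < -r (z k) := by
        have := (hmem (z k)).1 (hz k); linarith
      have hsq := hsymm (q k) (hfr hq1)
      have hgg : (inner ℂ (gradient r (z k)) (gradient r (z k)) : ℂ) = 1 := by
        rw [inner_self_eq_norm_sq_to_K, hg1]; simp
      refine ⟨ht, ?_, ?_⟩
      · refine hlevipos (q k) hq1 _ ?_
        rw [hq2, inner_sub_right, inner_smul_right, hgg]
        linear_combination 2 * htan k
      · have h1 := leviForm_div_add_eq (η := η) (K := K) ht.ne' hsq (fun v => by
          rw [neg_smul, ← sub_eq_add_neg]; exact hHeq v) (gradient r (z k)) (z k) (τ k) (σ k)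
        rw [← h1]
        linarith [hneg k]
    -- passage to the limit
    have hrem : Tendsto (fun k => remainder η K (-r (z (κ k))) (gradient r (z (κ k))) (z (κ k))
        (fderiv ℝ (gradient r) (q (κ k))) (fderiv ℝ (gradient r) (z (κ k))) (τ (κ k)) (σ (κ k)))
        atTop (𝓝 (remainder η K 0 (gradient r p) p (fderiv ℝ (gradient r) p)
          (fderiv ℝ (gradient r) p) τ' σ')) := by
      have h1 := hrl.neg
      rw [neg_zero] at h1
      exact tendsto_remainder η K h1 hgl hzl hHql hHl hτl hσl
    have hTl : Tendsto (fun k => τ (κ k) - (2 * (-r (z (κ k)) : ℝ) * σ (κ k)) • gradient r (z (κ k)))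
        atTop (𝓝 τ') := by
      have h1 : Tendsto (fun k => ((-r (z (κ k)) : ℝ) : ℂ)) atTop (𝓝 0) := by
        have := (Complex.continuous_ofReal.tendsto _).comp hrl.neg
        rw [neg_zero, Complex.ofReal_zero] at this
        exact this
      have := hτl.sub (((h1.const_mul 2).mul hσl).smul hgl)
      simpa using this
    have hLl := tendsto_leviForm hHql hTl
    have hremle : remainder η K 0 (gradient r p) p (fderiv ℝ (gradient r) p)
        (fderiv ℝ (gradient r) p) τ' σ' ≤ 0 := by
      refine le_of_tendsto hrem (Eventually.of_forall fun k => ?_)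
      obtain ⟨h1, h2, h3⟩ := hdec (κ k)
      have := div_nonneg h2 h1.le
      linarith
    have hτtan : (inner ℂ (gradient r p) τ' : ℂ) = 0 := by
      have h1 : Tendsto (fun k => (inner ℂ (gradient r (z (κ k))) (τ (κ k)) : ℂ)) atTop
          (𝓝 (inner ℂ (gradient r p) τ')) := hgl.inner hτl
      have h2 : Tendsto (fun k => 2 * ((-r (z (κ k)) : ℝ) * σ (κ k))) atTop (𝓝 0) := by
        have h3 := (Complex.continuous_ofReal.tendsto _).comp hrl.neg
        have := (h3.mul hσl).const_mul 2
        simpa using this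
      refine tendsto_nhds_unique h1 (h2.congr fun k => ?_)
      rw [← htan (κ k)]; ring
    -- Multiplying the violated inequality by -r bounds the Levi form of the tangential part by r
    -- times a convergent remainder, hence by 0 in the limit.
    have hLzero : leviForm (fderiv ℝ (gradient r) p) τ' = 0 := by
      refine le_antisymm ?_ (hlevipos p hpfr τ' hτtan)
      have h2 := hrl.mul hrem
      rw [zero_mul] at h2
      refine le_of_tendsto_of_tendsto' hLl h2 fun k => ?_
      obtain ⟨h1, -, h3⟩ := hdec (κ k)
      rw [div_add' _ _ _ h1.ne', div_lt_iff₀ h1] at h3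
      linarith
    have hnull : τ' ∈ leviNull Ω p := by
      have hdr := hdel p hpr
      refine ⟨?_, fun θ hθ => ?_⟩
      · change del (signedDist Ω) p τ' = 0
        rw [signedDist_eq_sgnDist, hr, hdr, hτtan, mul_zero]
      · change del (signedDist Ω) p θ = 0 at hθ
        rw [signedDist_eq_sgnDist, hr, hdr] at hθ
        have hθ' : (inner ℂ (gradient r p) θ : ℂ) = 0 := by simpa using hθ
        rw [signedDist_eq_sgnDist, hr, levi_eq_inner (hC2 p hpr),
          inner_clinPart_eq_zero_of_null (hsymm p hpr) (hlevipos p hpfr) hτtan hLzero hθ', mul_zero]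
    have hunit : ∀ᶠ w in 𝓝 p, ‖gradient r w‖ = 1 := by
      have h1 : ∀ᶠ w in 𝓝 p, ‖gradient (sgnDist Ω) w‖ = 1 := hpr.mono fun w hw => hw.2.1
      rwa [hr] at h1
    have hpos := remainder_pos (σ := σ') hη hη1 hK hlt hunit.self_of_nhds (fun v => by
        exact inner_fderiv_eq_zero_of_norm_eq_one (hgc1.differentiableAt (by norm_num)) hunit v)
      (hA p hpfr τ' hnull) (hR p hpfr) (by
        by_contra! h0
        have h1 := hp'.2
        simp only [h0.1, h0.2] at h1
        simp at h1)
    linarith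
  obtain ⟨ε, hε, hεε₀, hb⟩ := hbound
  refine ⟨ε, hε, fun z hz hd => ⟨hreg z (hd.trans_le hεε₀), fun τ => ?_⟩⟩
  have hzr := hreg z (hd.trans_le hεε₀)
  have ht : -r z ≠ 0 := by
    have := (hmem z).1 hz; linarith
  have := hb z hz hd τ (del r z τ / (-r z : ℝ)) (by
    rw [hdel z hzr]
    have : ((-r z : ℝ) : ℂ) ≠ 0 := by exact_mod_cast ht
    field_simp)
  rw [hlevi z hzr]
  exact this

end BoundaryEstimate

/-! ### A concave cutoff of the logarithm. -/

section Flattening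

/-- A concave function equal to the identity up to `a` and constant from `a + 1` on. -/
def flatten (a x : ℝ) : ℝ := a + ∫ y in a..x, (1 - Real.smoothTransition (y - a))

theorem continuous_flatten_integrand (a : ℝ) :
    Continuous fun y : ℝ => 1 - Real.smoothTransition (y - a) :=
  continuous_const.sub (Real.smoothTransition.continuous.comp (continuous_id.sub continuous_const))

theorem hasDerivAt_flatten (a x : ℝ) :
    HasDerivAt (flatten a) (1 - Real.smoothTransition (x - a)) x :=
  ((continuous_flatten_integrand a).integral_hasStrictDerivAt a x).hasDerivAt.const_add a

theorem deriv_flatten (a : ℝ) : deriv (flatten a) = fun x => 1 - Real.smoothTransition (x - a) :=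
  funext fun x => (hasDerivAt_flatten a x).deriv

theorem contDiff_deriv_flatten (a : ℝ) : ContDiff ℝ 1 (deriv (flatten a)) := by
  rw [deriv_flatten]
  exact contDiff_const.sub (Real.smoothTransition.contDiff.comp (contDiff_id.sub contDiff_const))

theorem contDiff_flatten (a : ℝ) : ContDiff ℝ 2 (flatten a) := by
  rw [show (2 : WithTop ℕ∞) = 1 + 1 by norm_num, contDiff_succ_iff_deriv]
  exact ⟨fun x => (hasDerivAt_flatten a x).differentiableAt, by simp, contDiff_deriv_flatten a⟩

theorem deriv_flatten_nonneg (a x : ℝ) : 0 ≤ deriv (flatten a) x := by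
  rw [deriv_flatten]
  have := Real.smoothTransition.le_one (x - a)
  simp only
  linarith

theorem deriv_flatten_le_one (a x : ℝ) : deriv (flatten a) x ≤ 1 := by
  rw [deriv_flatten]
  have := Real.smoothTransition.nonneg (x - a)
  simp only
  linarith

theorem deriv_deriv_flatten_nonpos (a x : ℝ) : deriv (deriv (flatten a)) x ≤ 0 := by
  have : Antitone (deriv (flatten a)) := by
    rw [deriv_flatten]
    intro x y hxy
    have := Real.smoothTransition.monotone (sub_le_sub_right hxy a)
    simp only
    linarith
  exact this.deriv_nonpos

theorem flatten_of_le {a x : ℝ} (h : x ≤ a) : flatten a x = x := by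
  have : ∫ y in a..x, (1 - Real.smoothTransition (y - a)) = ∫ y in a..x, (1 : ℝ) := by
    refine intervalIntegral.integral_congr fun y hy => ?_
    rw [uIcc_of_ge h] at hy
    rw [Real.smoothTransition.zero_of_nonpos (by linarith [hy.2]), sub_zero]
  rw [flatten, this]
  simp

theorem flatten_of_ge {a x : ℝ} (h : a + 1 ≤ x) : flatten a x = flatten a (a + 1) := by
  have h0 : ∫ y in (a + 1)..x, (1 - Real.smoothTransition (y - a)) = ∫ y in (a + 1)..x, (0 : ℝ) := by
    refine intervalIntegral.integral_congr fun y hy => ?_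
    rw [uIcc_of_le h] at hy
    rw [Real.smoothTransition.one_of_one_le (by linarith [hy.1]), sub_self]
  have hi := fun b c => (continuous_flatten_integrand a).intervalIntegrable (μ := MeasureTheory.volume) b c
  rw [flatten, flatten, ← intervalIntegral.integral_add_adjacent_intervals (hi a (a + 1)) (hi (a + 1) x),
    h0]
  simp

theorem flatten_monotone (a : ℝ) : Monotone (flatten a) :=
  monotone_of_deriv_nonneg (fun x => (hasDerivAt_flatten a x).differentiableAt)
    (deriv_flatten_nonneg a)

/-- Yields ρ ≤ -δ, once both ℓ and a are at least log δ. -/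
theorem min_le_flatten (a x : ℝ) : min x a ≤ flatten a x := by
  rcases le_total x a with h | h
  · rw [flatten_of_le h]; exact min_le_left _ _
  · refine (min_le_right _ _).trans ?_
    have := flatten_monotone a h
    rwa [flatten_of_le le_rfl] at this

/-- Yields the other bound -cδ ≤ ρ. -/
theorem flatten_le_self (a x : ℝ) : flatten a x ≤ x := by
  have hanti : Antitone fun x => flatten a x - x := by
    refine antitone_of_deriv_nonpos
      (fun x => ((hasDerivAt_flatten a x).sub (hasDerivAt_id x)).differentiableAt) fun x => ?_
    have h1 : HasDerivAt (fun x => flatten a x - x) _ x :=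
      (hasDerivAt_flatten a x).sub (hasDerivAt_id x)
    rw [h1.deriv]
    have := Real.smoothTransition.nonneg (x - a)
    linarith
  rcases le_total x a with h | h
  · rw [flatten_of_le h]
  · have := hanti h
    simp only [flatten_of_le (le_refl a), sub_self] at this
    linarith

end Flattening

/-! ### Complex Hessians of compositions. -/

section ChainRule

variable {n : ℕ}

theorem norm_del_sq {u : Cn n → ℝ} {z : Cn n} (h : DifferentiableAt ℝ u z) (τ : Cn n) :
    ‖del u z τ‖ ^ 2 = ((fderiv ℝ u z τ) ^ 2 + (fderiv ℝ u z (Complex.I • τ)) ^ 2) / 4 := by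
  rw [del_eq_inner h, fderiv_eq_inner_gradient, fderiv_eq_inner_gradient, real_inner_eq_re,
    real_inner_eq_re, inner_smul_right, ← Complex.normSq_eq_norm_sq, Complex.normSq_mul,
    Complex.normSq_apply (inner ℂ (gradient u z) τ)]
  simp
  ring

theorem levi_congr {u v : Cn n → ℝ} {z : Cn n} (hv : ContDiffAt ℝ 2 v z) (h : u =ᶠ[𝓝 z] v)
    (τ : Cn n) : (levi u z τ τ).re = (levi v z τ τ).re := by
  rw [levi_self_re hv, levi_self_re (hv.congr_of_eventuallyEq h), h.fderiv.fderiv_eq]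

theorem levi_const (c : ℝ) (z τ : Cn n) : (levi (fun _ => c) z τ τ).re = 0 := by
  rw [levi_self_re contDiffAt_const]
  simp

/-- The complex Hessian of a composition. -/
theorem levi_comp {f : ℝ → ℝ} {u : Cn n → ℝ} {z : Cn n} (hf : ContDiff ℝ 2 f)
    (hu : ContDiffAt ℝ 2 u z) (τ : Cn n) :
    (levi (fun w => f (u w)) z τ τ).re =
      deriv f (u z) * (levi u z τ τ).re + deriv (deriv f) (u z) * ‖del u z τ‖ ^ 2 := by
  have hcomp : ContDiffAt ℝ 2 (fun w => f (u w)) z := hf.contDiffAt.comp z hu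
  have hfd : ContDiff ℝ 1 (deriv f) := by
    rw [show (2 : WithTop ℕ∞) = 1 + 1 by norm_num, contDiff_succ_iff_deriv] at hf
    exact hf.2.2
  have h1 : fderiv ℝ (fun w => f (u w)) =ᶠ[𝓝 z] fun w => deriv f (u w) • fderiv ℝ u w := by
    filter_upwards [eventually_differentiableAt hu] with w hw
    exact ((hf.differentiable (by norm_num) (u w)).hasDerivAt.comp_hasFDerivAt w hw.hasFDerivAt).fderiv
  have hud := (hu.differentiableAt (by norm_num))
  have h2 : HasFDerivAt (fun w => deriv f (u w)) (deriv (deriv f) (u z) • fderiv ℝ u z) z :=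
    (hfd.differentiable (by norm_num) (u z)).hasDerivAt.comp_hasFDerivAt z hud.hasFDerivAt
  have h3 : HasFDerivAt (fderiv ℝ u) (fderiv ℝ (fderiv ℝ u) z) z :=
    ((hu.fderiv_right (m := 1) (by norm_num)).differentiableAt (by norm_num)).hasFDerivAt
  have h4 := (h2.smul h3).congr_of_eventuallyEq h1
  rw [levi_self_re hcomp, levi_self_re hu, norm_del_sq hud, h4.fderiv]
  simp
  ring

/-- First and second order data of `log |r| - K |z|² + C`. -/
theorem log_weight_calculus {r : Cn n → ℝ} {z : Cn n} (hr : ContDiffAt ℝ 2 r z) (hz : r z ≠ 0)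
    (K C : ℝ) (τ : Cn n) :
    ContDiffAt ℝ 2 (fun w => Real.log (r w) - K * ‖w‖ ^ 2 + C) z ∧
    del (fun w => Real.log (r w) - K * ‖w‖ ^ 2 + C) z τ = del r z τ / r z - K * inner ℂ z τ ∧
    (levi (fun w => Real.log (r w) - K * ‖w‖ ^ 2 + C) z τ τ).re =
      (levi r z τ τ).re / r z - ‖del r z τ / r z‖ ^ 2 - K * ‖τ‖ ^ 2 := by
  obtain ⟨B, hB⟩ : ∃ B : Cn n →L[ℝ] Cn n →L[ℝ] ℝ, ∀ v w, B v w = inner ℝ v w :=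
    ⟨innerSL ℝ, fun _ _ => rfl⟩
  have hsq : ∀ w : Cn n, HasFDerivAt (fun w : Cn n => ‖w‖ ^ 2) ((2 : ℝ) • B w) w := fun w =>
    (hasStrictFDerivAt_norm_sq w).hasFDerivAt.congr_fderiv (by ext v; simp [hB])
  have hc : ContDiffAt ℝ 2 (fun w => Real.log (r w) - K * ‖w‖ ^ 2 + C) z :=
    ((hr.log hz).sub (contDiffAt_const.mul (contDiffAt_id.norm_sq ℝ))).add contDiffAt_const
  have hfd : ∀ w, DifferentiableAt ℝ r w → r w ≠ 0 →
      HasFDerivAt (fun w => Real.log (r w) - K * ‖w‖ ^ 2 + C)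
        ((r w)⁻¹ • fderiv ℝ r w - K • ((2 : ℝ) • B w)) w := fun w hw h0 =>
    ((hw.hasFDerivAt.log h0).sub ((hsq w).const_mul K)).add_const C
  have hrd := hr.differentiableAt (by norm_num)
  refine ⟨hc, ?_, ?_⟩
  · have hg : gradient (fun w => Real.log (r w) - K * ‖w‖ ^ 2 + C) z =
        (r z)⁻¹ • gradient r z - (2 * K) • z := by
      refine ext_inner_right ℝ fun v => ?_
      rw [inner_gradient_left, (hfd z hrd hz).fderiv, inner_sub_left, real_inner_smul_left,
        real_inner_smul_left, inner_gradient_left]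
      simp [hB]
      ring
    rw [del_eq_inner (hc.differentiableAt (by norm_num)), hg, del_eq_inner hrd, inner_sub_left,
      real_smul_eq, real_smul_eq, inner_smul_left, inner_smul_left]
    simp [Complex.conj_ofNat]
    ring
  · have hev : ∀ᶠ w in 𝓝 z, r w ≠ 0 := hr.continuousAt.eventually_ne hz
    have h1 : fderiv ℝ (fun w => Real.log (r w) - K * ‖w‖ ^ 2 + C) =ᶠ[𝓝 z]
        fun w => (r w)⁻¹ • fderiv ℝ r w - K • ((2 : ℝ) • B w) := by
      filter_upwards [eventually_differentiableAt hr, hev] with w hw h0 using (hfd w hw h0).fderiv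
    have h3 : HasFDerivAt (fderiv ℝ r) (fderiv ℝ (fderiv ℝ r) z) z :=
      ((hr.fderiv_right (m := 1) (by norm_num)).differentiableAt (by norm_num)).hasFDerivAt
    have hinv : HasFDerivAt (fun w => (r w)⁻¹) (-((r z) ^ 2)⁻¹ • fderiv ℝ r z) z :=
      (hasDerivAt_inv hz).comp_hasFDerivAt z hrd.hasFDerivAt
    have hin : HasFDerivAt (fun w : Cn n => K • ((2 : ℝ) • B w)) (K • ((2 : ℝ) • B)) z :=
      ((B.hasFDerivAt (x := z)).const_smul (2 : ℝ)).const_smul K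
    have h4 := ((hinv.smul h3).sub hin).congr_of_eventuallyEq h1
    have hI : ‖Complex.I • τ‖ = ‖τ‖ := by rw [norm_smul, Complex.norm_I, one_mul]
    rw [levi_self_re hc, levi_self_re hr, norm_div, div_pow, norm_del_sq hrd, h4.fderiv,
      Complex.norm_real, Real.norm_eq_abs, sq_abs]
    simp only [sub_apply, add_apply, smul_apply, smul_eq_mul, hB, real_inner_self_eq_norm_sq, hI,
      ContinuousLinearMap.smulRight_apply]
    field_simp
    ring

end ChainRule

/-! ### Construction of the defining function and choice of the weight. -/

section Index

variable {n : ℕ}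

theorem frontier_subset_regularSet {Ω : Set (Cn n)} (hΩ : IsOpen Ω) (h : HasC2Boundary Ω) :
    frontier Ω ⊆ regularSet Ω := by
  intro p hp
  obtain ⟨U, ρ, hU, hpU, hρ, hd, hdef⟩ := h p hp
  exact sgnDist_eventually_regular hΩ hU hpU hρ (gradient_ne_zero hd) hdef hp

theorem norm_alphaForm_le {g : Cn n} (hg : ‖g‖ = 1) (H : Cn n →L[ℝ] Cn n) (τ : Cn n) :
    ‖alphaForm g H τ‖ ≤ ‖H‖ * ‖τ‖ := by
  have h1 := norm_inner_le_norm (𝕜 := ℂ) g (H τ)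
  have h2 := norm_inner_le_norm (𝕜 := ℂ) g (H (Complex.I • τ))
  have h3 := H.le_opNorm τ
  have h4 := H.le_opNorm (Complex.I • τ)
  rw [norm_smul, Complex.norm_I, one_mul] at h4
  rw [hg, one_mul] at h1 h2
  have h5 := norm_sub_le (inner ℂ g (H τ)) (Complex.I * inner ℂ g (H (Complex.I • τ)))
  rw [norm_mul, Complex.norm_I, one_mul] at h5
  rw [alphaForm, norm_mul]
  have : ‖(1 / 2 : ℂ)‖ = 1 / 2 := by norm_num
  rw [this]
  linarith

/-- Origin of √2 in the theorem: α is half of `alphaForm`, while the metric length is the Euclidean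
one divided by √2. -/
theorem norm_alpha_div {Ω : Set (Cn n)} {p : Cn n} (hp : p ∈ regularSet Ω) (τ : Cn n) :
    ‖alpha Ω p τ‖ / vecNorm τ =
      ‖alphaForm (gradient (sgnDist Ω) p) (fderiv ℝ (gradient (sgnDist Ω)) p) τ‖ /
        (Real.sqrt 2 * ‖τ‖) := by
  rw [alpha_eq hp.self_of_nhds.1, vecNorm, ← alphaForm_eq, norm_mul]
  have h1 : ‖(1 / 2 : ℂ)‖ = 1 / 2 := by norm_num
  have h2 : Real.sqrt 2 * Real.sqrt 2 = 2 := Real.mul_self_sqrt (by norm_num)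
  have h3 : Real.sqrt 2 ≠ 0 := by positivity
  rw [h1]
  by_cases hτ : ‖τ‖ = 0
  · simp [hτ]
  · field_simp
    linear_combination ‖alphaForm (gradient (sgnDist Ω) p)
      (fderiv ℝ (gradient (sgnDist Ω)) p) τ‖ * h2

/-- The Hessian of the signed distance is continuous on the compact boundary and bounds α. -/
theorem bddAbove_alphaRatios {Ω : Set (Cn n)} (hbdd : Bornology.IsBounded Ω)
    (hfr : frontier Ω ⊆ regularSet Ω) : BddAbove (alphaRatios Ω) := by
  have hfc : IsCompact (frontier Ω) :=
    hbdd.isCompact_closure.of_isClosed_subset isClosed_frontier frontier_subset_closure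
  have hcont : ContinuousOn (fun p => ‖fderiv ℝ (gradient (sgnDist Ω)) p‖) (frontier Ω) := by
    intro p hp
    have h1 : ContDiffAt ℝ 1 (gradient (sgnDist Ω)) p :=
      contDiffAt_gradient (hfr hp).self_of_nhds.1
    exact ((h1.fderiv_right (m := 0) (by norm_num)).continuousAt.norm).continuousWithinAt
  obtain ⟨M, hM⟩ := hfc.bddAbove_image hcont
  refine ⟨M, ?_⟩
  rintro a ⟨p, hp, τ, -, hτ, rfl⟩
  have hτ' : 0 < ‖τ‖ := norm_pos_iff.2 hτ
  have hMp : ‖fderiv ℝ (gradient (sgnDist Ω)) p‖ ≤ M := hM ⟨p, hp, rfl⟩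
  have hM0 : 0 ≤ M := (norm_nonneg _).trans hMp
  rw [norm_alpha_div (hfr hp), div_le_iff₀ (by positivity)]
  refine (norm_alphaForm_le (hfr hp).self_of_nhds.2.1 _ τ).trans ?_
  have h1 : (1 : ℝ) ≤ Real.sqrt 2 := by rw [Real.one_le_sqrt]; norm_num
  calc _ ≤ M * ‖τ‖ := by gcongr
    _ ≤ M * (Real.sqrt 2 * ‖τ‖) := by
      gcongr
      exact le_mul_of_one_le_left hτ'.le h1

/-- The composition of the weighted logarithm with the flattening is plurisubharmonic. -/
theorem levi_neg_exp_flatten_nonneg {ℓ : Cn n → ℝ} {z : Cn n} (hℓ : ContDiffAt ℝ 2 ℓ z) {η : ℝ}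
    (hη : 0 < η) (a : ℝ) (τ : Cn n) (h : η * ‖del ℓ z τ‖ ^ 2 ≤ -(levi ℓ z τ τ).re) :
    0 ≤ (levi (fun w => -Real.exp (η * flatten a (ℓ w))) z τ τ).re := by
  have hk1 : ∀ x, HasDerivAt (flatten a) (deriv (flatten a) x) x :=
    fun x => (hasDerivAt_flatten a x).differentiableAt.hasDerivAt
  have hk2 : ∀ x, HasDerivAt (deriv (flatten a)) (deriv (deriv (flatten a)) x) x :=
    fun x => ((contDiff_deriv_flatten a).differentiable (by norm_num) x).hasDerivAt
  have hf : ContDiff ℝ 2 fun x => -Real.exp (η * flatten a x) :=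
    (Real.contDiff_exp.comp (contDiff_const.mul (contDiff_flatten a))).neg
  have hd1 : deriv (fun x => -Real.exp (η * flatten a x)) =
      fun x => -(Real.exp (η * flatten a x) * (η * deriv (flatten a) x)) :=
    funext fun x => (((hk1 x).const_mul η).exp.neg).deriv
  have hd2 : ∀ x, deriv (deriv fun x => -Real.exp (η * flatten a x)) x =
      -(Real.exp (η * flatten a x) * (η * deriv (flatten a) x) * (η * deriv (flatten a) x) +
        Real.exp (η * flatten a x) * (η * deriv (deriv (flatten a)) x)) := by
    intro x
    rw [hd1]
    exact (((((hk1 x).const_mul η).exp).mul ((hk2 x).const_mul η)).neg).deriv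
  rw [levi_comp hf hℓ, hd2, hd1]
  simp only
  set k1 := deriv (flatten a) (ℓ z)
  set k2 := deriv (deriv (flatten a)) (ℓ z)
  set e := Real.exp (η * flatten a (ℓ z))
  have he : 0 < e := Real.exp_pos _
  have h1 : 0 ≤ k1 := deriv_flatten_nonneg a _
  have h2 : k1 ≤ 1 := deriv_flatten_le_one a _
  have h3 : k2 ≤ 0 := deriv_deriv_flatten_nonpos a _
  set D := ‖del ℓ z τ‖ ^ 2
  have hD : 0 ≤ D := sq_nonneg _
  have h4 : k1 * (η * D) ≤ k1 * -(levi ℓ z τ τ).re := mul_le_mul_of_nonneg_left h h1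
  -- With k the flattening, 0 ≤ k' ≤ 1 gives ηk'² ≤ ηk', which the hypothesis absorbs, and k'' ≤ 0
  -- only helps.
  have h5 : 0 ≤ η * e * (k1 * -(levi ℓ z τ τ).re - η * k1 ^ 2 * D - k2 * D) := by
    have h6 : 0 ≤ η * D * (k1 * (1 - k1)) := by
      have : 0 ≤ 1 - k1 := by linarith
      positivity
    have h7 : 0 ≤ -k2 * D := mul_nonneg (by linarith) hD
    have h8 : 0 ≤ k1 * -(levi ℓ z τ τ).re - η * k1 ^ 2 * D - k2 * D := by nlinarith
    positivity
  linarith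

open Classical in
/-- The defining function with a plurisubharmonic power. -/
def dfFunction (Ω : Set (Cn n)) (K C a : ℝ) (z : Cn n) : ℝ :=
  if z ∈ Ω then -Real.exp (flatten a (Real.log (sgnDist Ω z) - K * ‖z‖ ^ 2 + C))
  else sgnDist Ω z * Real.exp (C - K * ‖z‖ ^ 2)

theorem isDFExponent_of_lt {Ω : Set (Cn n)} (hΩ : IsOpen Ω) (hbdd : Bornology.IsBounded Ω)
    (hpsc : IsPseudoconvex Ω) (hfr : frontier Ω ⊆ regularSet Ω) (hne : (frontier Ω).Nonempty)
    {η K A R : ℝ} (hη : 0 < η) (hη1 : η < 1) (hK : 0 ≤ K)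
    (hlt : η * (A + K * R) ^ 2 < (1 - η) * K) (hR : ∀ p ∈ closure Ω, ‖p‖ ≤ R)
    (hA : ∀ p ∈ frontier Ω, ∀ τ ∈ leviNull Ω p,
      ‖alphaForm (gradient (sgnDist Ω) p) (fderiv ℝ (gradient (sgnDist Ω)) p) τ‖ ≤ A * ‖τ‖) :
    IsDFExponent Ω η := by
  obtain ⟨ε₁, hε₁, hest⟩ := exists_boundary_estimate hΩ hbdd hpsc hfr hne hη hη1 hK hlt
    (fun p hp => hR p (frontier_subset_closure hp)) hA
  have hfc : IsCompact (frontier Ω) :=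
    hbdd.isCompact_closure.of_isClosed_subset isClosed_frontier frontier_subset_closure
  obtain ⟨ε₀, hε₀, hth⟩ := hfc.exists_thickening_subset_open (isOpen_regularSet Ω) hfr
  have hreg : ∀ z, Metric.infDist z (frontier Ω) < ε₀ → ContDiffAt ℝ 2 (sgnDist Ω) z := fun z hz =>
    (hth ((Metric.mem_thickening_iff_infDist_lt hne).2 hz)).self_of_nhds.1
  set ε := min ε₀ ε₁ with hεdef
  have hε : 0 < ε := lt_min hε₀ hε₁
  have hmem := mem_iff_sgnDist_neg hΩ hne
  have hδ : ∀ z ∈ Ω, Metric.infDist z (frontier Ω) = -sgnDist Ω z := fun z hz => by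
    simp [sgnDist, hz]
  obtain ⟨p₀, hp₀⟩ := hne
  have hR0 : 0 ≤ R := (norm_nonneg _).trans (hR p₀ (frontier_subset_closure hp₀))
  set D := 2 * R + 1 with hD
  have hD0 : 0 < D := by positivity
  have hδD : ∀ z ∈ Ω, Metric.infDist z (frontier Ω) ≤ D := fun z hz => by
    have h1 := Metric.infDist_le_dist_of_mem (x := z) hp₀
    have h2 := dist_le_norm_add_norm z p₀
    have h3 := hR z (subset_closure hz)
    have h4 := hR p₀ (frontier_subset_closure hp₀)
    linarith
  -- C ≥ KR² gives ℓ ≥ log δ, and C > 0 gives e^C > 1. The level a is chosen so that δ ≥ ε/2 implies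
  -- ℓ ≥ a + 1, while the absolute values in C keep a ≥ log D ≥ log δ.
  set C := K * R ^ 2 + 1 + |Real.log D| + |Real.log (ε / 2)| with hC
  set a := Real.log (ε / 2) + C - K * R ^ 2 - 1 with ha
  have hCR : K * R ^ 2 ≤ C := by
    have := abs_nonneg (Real.log D); have := abs_nonneg (Real.log (ε / 2)); linarith
  have hC0 : 0 < C := by
    have := abs_nonneg (Real.log D); have := abs_nonneg (Real.log (ε / 2))
    have : 0 ≤ K * R ^ 2 := by positivity
    linarith
  have haD : Real.log D ≤ a := by
    have := le_abs_self (Real.log D); have := neg_abs_le (Real.log (ε / 2)); linarith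
  have hKz : ∀ z ∈ closure Ω, K * ‖z‖ ^ 2 ≤ K * R ^ 2 := fun z hz => by
    have := hR z hz
    gcongr
  -- `Real.log` depends only on the absolute value, so inside Ω the logarithm of the negative signed
  -- distance is log δ.
  set ℓ : Cn n → ℝ := fun w => Real.log (sgnDist Ω w) - K * ‖w‖ ^ 2 + C with hℓ
  have hρin : ∀ z ∈ Ω, dfFunction Ω K C a z = -Real.exp (flatten a (ℓ z)) := fun z hz => by
    simp [dfFunction, hz, hℓ]
  have hexpℓ : ∀ z ∈ Ω, Real.exp (ℓ z) = -sgnDist Ω z * Real.exp (C - K * ‖z‖ ^ 2) := by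
    intro z hz
    have h1 := (hmem z).1 hz
    have : ℓ z = Real.log (-sgnDist Ω z) + (C - K * ‖z‖ ^ 2) := by
      rw [hℓ, Real.log_neg_eq_log]; ring
    rw [this, Real.exp_add, Real.exp_log (by linarith)]
  have hlogδ : ∀ z ∈ Ω, Real.log (Metric.infDist z (frontier Ω)) = Real.log (sgnDist Ω z) :=
    fun z hz => by rw [hδ z hz, Real.log_neg_eq_log]
  have hδpos : ∀ z ∈ Ω, 0 < Metric.infDist z (frontier Ω) := fun z hz => by
    rw [hδ z hz]; linarith [(hmem z).1 hz]
  -- near the boundary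
  set ε₂ := min ε (Real.exp (a - C)) with hε₂
  have hε₂0 : 0 < ε₂ := lt_min hε (Real.exp_pos _)
  -- δ < e^{a-C} forces ℓ ≤ a, where the flattening is the identity. Both branches then agree with
  -- one formula that is C² across the boundary.
  have hρbd : ∀ z, Metric.infDist z (frontier Ω) < ε₂ →
      dfFunction Ω K C a z = sgnDist Ω z * Real.exp (C - K * ‖z‖ ^ 2) := by
    intro z hz
    by_cases hzΩ : z ∈ Ω
    · have h1 : ℓ z ≤ a := by
        have h2 : Real.log (Metric.infDist z (frontier Ω)) ≤ a - C := by
          rw [Real.log_le_iff_le_exp (hδpos z hzΩ)]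
          exact (hz.trans_le (min_le_right _ _)).le
        rw [hlogδ z hzΩ] at h2
        have : 0 ≤ K * ‖z‖ ^ 2 := by positivity
        simp only [hℓ]
        linarith
      rw [hρin z hzΩ, flatten_of_le h1, hexpℓ z hzΩ]
      ring
    · simp [dfFunction, hzΩ]
  have hdeep : ∀ z ∈ Ω, ε / 2 ≤ Metric.infDist z (frontier Ω) →
      flatten a (ℓ z) = flatten a (a + 1) := by
    intro z hz hd
    refine flatten_of_ge ?_
    have h1 := Real.log_le_log (by positivity) hd
    rw [hlogδ z hz] at h1
    have h2 := hKz z (subset_closure hz)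
    simp only [hℓ, ha]
    linarith
  have hℓc : ∀ z ∈ Ω, Metric.infDist z (frontier Ω) < ε → ContDiffAt ℝ 2 ℓ z := fun z hz hd =>
    (log_weight_calculus (hreg z (hd.trans_le (min_le_left _ _))) ((hmem z).1 hz).ne K C 0).1
  have hcontδ : Continuous fun z : Cn n => Metric.infDist z (frontier Ω) :=
    Metric.continuous_infDist_pt _
  -- The gap between ε/2 and ε makes the function constant on a neighborhood of z. Smoothness of the
  -- distance is thus never needed there.
  have hdeepev : ∀ z ∈ Ω, ε ≤ Metric.infDist z (frontier Ω) →
      ∀ᶠ w in 𝓝 z, w ∈ Ω ∧ flatten a (ℓ w) = flatten a (a + 1) := by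
    intro z hz hd
    filter_upwards [hΩ.mem_nhds hz, hcontδ.continuousAt.eventually
      (lt_mem_nhds ((half_lt_self hε).trans_le hd))] with w hw1 hw2
    exact ⟨hw1, hdeep w hw1 hw2.le⟩
  refine ⟨dfFunction Ω K C a, ⟨Ω ∪ {z | Metric.infDist z (frontier Ω) < ε₂},
    hΩ.union (isOpen_lt hcontδ continuous_const), ?_, ?_⟩, ⟨Real.exp C, ?_, ?_⟩, ?_, ?_⟩
  · intro z hz
    by_cases hzΩ : z ∈ Ω
    · exact Or.inl hzΩ
    · right
      have h1 : z ∈ frontier Ω := by rw [hΩ.frontier_eq]; exact ⟨hz, hzΩ⟩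
      simpa [Metric.infDist_zero_of_mem h1] using hε₂0
  · intro z hz
    refine ContDiffAt.contDiffWithinAt ?_
    by_cases hd : Metric.infDist z (frontier Ω) < ε₂
    · have h1 : ContDiffAt ℝ 2 (fun w => sgnDist Ω w * Real.exp (C - K * ‖w‖ ^ 2)) z :=
        (hreg z (hd.trans_le ((min_le_left _ _).trans (min_le_left _ _)))).mul
          (contDiffAt_const.sub (contDiffAt_const.mul (contDiffAt_id.norm_sq ℝ))).exp
      refine h1.congr_of_eventuallyEq ?_
      filter_upwards [hcontδ.continuousAt.eventually (gt_mem_nhds hd)] with w hw using hρbd w hw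
    · have hzΩ : z ∈ Ω := hz.resolve_right hd
      rcases lt_or_ge (Metric.infDist z (frontier Ω)) ε with hlt' | hge
      · have h1 : ContDiffAt ℝ 2 (fun w => -Real.exp (flatten a (ℓ w))) z :=
          (((contDiff_flatten a).contDiffAt.comp z (hℓc z hzΩ hlt')).exp).neg
        refine h1.congr_of_eventuallyEq ?_
        filter_upwards [hΩ.mem_nhds hzΩ] with w hw using hρin w hw
      · have h1 : ContDiffAt ℝ 2 (fun _ : Cn n => -Real.exp (flatten a (a + 1))) z :=
          contDiffAt_const
        refine h1.congr_of_eventuallyEq ?_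
        filter_upwards [hdeepev z hzΩ hge] with w hw
        rw [hρin w hw.1, hw.2]
  · simpa using hC0
  · intro z hz
    rw [bdist]
    by_cases hzΩ : z ∈ Ω
    · rw [hρin z hzΩ]
      have hpos := hδpos z hzΩ
      have h2 := hKz z hz
      have hK0 : 0 ≤ K * ‖z‖ ^ 2 := by positivity
      constructor
      · have h1 : Real.exp (flatten a (ℓ z)) ≤ Real.exp (ℓ z) :=
          Real.exp_le_exp.2 (flatten_le_self _ _)
        rw [hexpℓ z hzΩ, ← hδ z hzΩ] at h1
        have h3 : Real.exp (C - K * ‖z‖ ^ 2) ≤ Real.exp C := Real.exp_le_exp.2 (by linarith)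
        nlinarith
      · rw [neg_le_neg_iff, ← Real.log_le_iff_le_exp hpos]
        refine le_trans (le_min ?_ ?_) (min_le_flatten a (ℓ z))
        · rw [hlogδ z hzΩ]
          simp only [hℓ]
          linarith
        · exact (Real.log_le_log hpos (hδD z hzΩ)).trans haD
    · have h1 : z ∈ frontier Ω := by rw [hΩ.frontier_eq]; exact ⟨hz, hzΩ⟩
      simp [dfFunction, hzΩ, sgnDist, Metric.infDist_zero_of_mem h1]
  · intro z hzΩ
    refine ContDiffAt.contDiffWithinAt ?_
    have hev : (fun w => -(-dfFunction Ω K C a w) ^ η) =ᶠ[𝓝 z]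
        fun w => -Real.exp (η * flatten a (ℓ w)) := by
      filter_upwards [hΩ.mem_nhds hzΩ] with w hw
      rw [hρin w hw, neg_neg, ← Real.exp_mul, mul_comm]
    rcases lt_or_ge (Metric.infDist z (frontier Ω)) ε with hlt' | hge
    · have h1 : ContDiffAt ℝ 2 (fun w => -Real.exp (η * flatten a (ℓ w))) z :=
        ((contDiffAt_const.mul ((contDiff_flatten a).contDiffAt.comp z (hℓc z hzΩ hlt'))).exp).neg
      exact h1.congr_of_eventuallyEq hev
    · have h1 : ContDiffAt ℝ 2 (fun _ : Cn n => -Real.exp (η * flatten a (a + 1))) z :=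
        contDiffAt_const
      refine h1.congr_of_eventuallyEq (hev.trans ?_)
      filter_upwards [hdeepev z hzΩ hge] with w hw
      rw [hw.2]
  · intro z hzΩ τ
    have hev : (fun w => -(-dfFunction Ω K C a w) ^ η) =ᶠ[𝓝 z]
        fun w => -Real.exp (η * flatten a (ℓ w)) := by
      filter_upwards [hΩ.mem_nhds hzΩ] with w hw
      rw [hρin w hw, neg_neg, ← Real.exp_mul, mul_comm]
    rcases lt_or_ge (Metric.infDist z (frontier Ω)) ε with hlt' | hge
    · have h1 : ContDiffAt ℝ 2 (fun w => -Real.exp (η * flatten a (ℓ w))) z :=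
        ((contDiffAt_const.mul ((contDiff_flatten a).contDiffAt.comp z (hℓc z hzΩ hlt'))).exp).neg
      rw [levi_congr h1 hev]
      refine levi_neg_exp_flatten_nonneg (hℓc z hzΩ hlt') hη a τ ?_
      have hr0 : sgnDist Ω z ≠ 0 := ((hmem z).1 hzΩ).ne
      obtain ⟨-, e1, e2⟩ := log_weight_calculus
        (hreg z (hlt'.trans_le (min_le_left _ _))) hr0 K C τ
      have h2 := (hest z hzΩ (hlt'.trans_le (min_le_right _ _))).2 τ
      rw [e1, e2]
      have e3 : ‖del (sgnDist Ω) z τ / (sgnDist Ω z : ℂ) - K * inner ℂ z τ‖ =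
          ‖del (sgnDist Ω) z τ / (-sgnDist Ω z : ℝ) + K * inner ℂ z τ‖ := by
        rw [← norm_neg]
        congr 1
        push_cast
        rw [div_neg]
        ring
      have e4 : ‖del (sgnDist Ω) z τ / (-sgnDist Ω z : ℝ)‖ =
          ‖del (sgnDist Ω) z τ / (sgnDist Ω z : ℂ)‖ := by
        push_cast
        rw [div_neg, norm_neg]
      rw [e4, div_neg] at h2
      rw [e3]
      linarith
    · rw [levi_congr contDiffAt_const (hev.trans (g := fun w => -Real.exp (η * flatten a (ℓ w)))
        (h := fun _ => -Real.exp (η * flatten a (a + 1))) (by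
          filter_upwards [hdeepev z hzΩ hge] with w hw
          rw [hw.2])), levi_const]

/-- K = a/R minimizes (a + KR)²/K, with value 4aR. If a = 0 a small positive K works, and if R = 0 a
large one. -/
theorem exists_weight {η a R : ℝ} (hη : 0 < η) (hη1 : η < 1) (ha : 0 ≤ a) (hR : 0 ≤ R)
    (h : η * (1 + 4 * a * R) < 1) : ∃ K, 0 ≤ K ∧ η * (a + K * R) ^ 2 < (1 - η) * K := by
  have h1 : 0 < 1 - η := by linarith
  rcases ha.eq_or_lt with rfl | ha
  · refine ⟨(1 - η) / (η * (R ^ 2 + 1)), by positivity, ?_⟩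
    have e : η * (0 + (1 - η) / (η * (R ^ 2 + 1)) * R) ^ 2 =
        (1 - η) * ((1 - η) / (η * (R ^ 2 + 1))) * (R ^ 2 / (R ^ 2 + 1)) := by
      field_simp
      ring
    rw [e]
    have h2 : R ^ 2 / (R ^ 2 + 1) < 1 := by rw [div_lt_one (by positivity)]; linarith
    exact mul_lt_of_lt_one_right (by positivity) h2
  · rcases hR.eq_or_lt with rfl | hR
    · refine ⟨η * a ^ 2 / (1 - η) + 1, by positivity, ?_⟩
      have e : (1 - η) * (η * a ^ 2 / (1 - η) + 1) = η * a ^ 2 + (1 - η) := by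
        field_simp
      rw [e]
      simp
      linarith
    · refine ⟨a / R, by positivity, ?_⟩
      have e : a + a / R * R = 2 * a := by field_simp; ring
      rw [e, ← mul_div_assoc, lt_div_iff₀ hR]
      nlinarith

theorem le_dfIndex {Ω : Set (Cn n)} {x : ℝ} (hx : x ≤ 1)
    (h : ∀ η, 0 < η → η < 1 → η < x → IsDFExponent Ω η) (hx0 : 0 < x) : x ≤ dfIndex Ω := by
  refine le_of_forall_lt fun y hy => ?_
  obtain ⟨η, h1, h2⟩ := exists_between (max_lt hy hx0)
  have h3 : 0 < η := (le_max_right _ _).trans_lt h1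
  have h4 : η < 1 := h2.trans_le hx
  refine ((le_max_left _ _).trans_lt h1).trans_le (le_csSup ⟨1, ?_⟩ ⟨h3, h4, h η h3 h4 h2⟩)
  rintro b ⟨-, hb, -⟩
  exact hb.le

/-- The distance to the empty set is 0 by convention, so ρ = 0 is comparable to it. For a nonempty
bounded open set this case occurs only in dimension 0. -/
theorem isDFExponent_of_frontier_eq_empty {Ω : Set (Cn n)} (h : frontier Ω = ∅)
    (η : ℝ) : IsDFExponent Ω η := by
  refine ⟨fun _ => 0, ⟨univ, isOpen_univ, subset_univ _, contDiffOn_const⟩, ⟨2, by norm_num, ?_⟩,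
    contDiffOn_const, ?_⟩
  · intro z _
    simp [bdist, h]
  · intro z _ τ
    rw [levi_const]

end Index

end DFIndex

end

theorem mainTheorem5 (n : ℕ) (Ω : Set (DFIndex.Cn n))
    (hopen : IsOpen Ω) (hconn : IsConnected Ω) (hbdd : Bornology.IsBounded Ω)
    (hpsc : DFIndex.IsPseudoconvex Ω) (hC2 : DFIndex.HasC2Boundary Ω) :
    BddAbove (DFIndex.alphaRatios Ω) ∧
    1 / (1 + 4 * Real.sqrt 2 * DFIndex.alphaSup Ω * DFIndex.supNorm Ω)
      ≤ DFIndex.dfIndex Ω := by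
  have hfr := DFIndex.frontier_subset_regularSet hopen hC2
  have hba := DFIndex.bddAbove_alphaRatios hbdd hfr
  refine ⟨hba, ?_⟩
  have hA0 : 0 ≤ DFIndex.alphaSup Ω := Real.sSup_nonneg (by
    rintro a ⟨p, -, τ, -, -, rfl⟩
    exact div_nonneg (norm_nonneg _) (div_nonneg (norm_nonneg _) (Real.sqrt_nonneg _)))
  have hR0 : 0 ≤ DFIndex.supNorm Ω := Real.sSup_nonneg (by
    rintro a ⟨z, -, rfl⟩
    exact norm_nonneg z)
  have hden : 1 ≤ 1 + 4 * Real.sqrt 2 * DFIndex.alphaSup Ω * DFIndex.supNorm Ω := by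
    have : 0 ≤ 4 * Real.sqrt 2 * DFIndex.alphaSup Ω * DFIndex.supNorm Ω := by positivity
    linarith
  have hden0 : 0 < 1 + 4 * Real.sqrt 2 * DFIndex.alphaSup Ω * DFIndex.supNorm Ω := by linarith
  refine DFIndex.le_dfIndex ((div_le_one hden0).2 hden) (fun η hη hη1 hlt => ?_) (by positivity)
  rcases (frontier Ω).eq_empty_or_nonempty with hemp | hne
  · exact DFIndex.isDFExponent_of_frontier_eq_empty hemp η
  have hRcl : ∀ p ∈ closure Ω, ‖p‖ ≤ DFIndex.supNorm Ω := by
    obtain ⟨M, hM⟩ := hbdd.exists_norm_le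
    have hb : BddAbove ((fun z => ‖z‖) '' Ω) := ⟨M, by rintro _ ⟨z, hz, rfl⟩; exact hM z hz⟩
    have hsub : closure Ω ⊆ {z | ‖z‖ ≤ DFIndex.supNorm Ω} :=
      closure_minimal (fun z hz => le_csSup hb ⟨z, hz, rfl⟩)
        (isClosed_le continuous_norm continuous_const)
    exact fun p hp => hsub hp
  -- The factor √2 converts A into a bound for `alphaForm` relative to Euclidean length.
  obtain ⟨K, hK, hKlt⟩ := DFIndex.exists_weight (a := Real.sqrt 2 * DFIndex.alphaSup Ω)
    (R := DFIndex.supNorm Ω) hη hη1 (by positivity) hR0 (by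
      rw [lt_div_iff₀ hden0] at hlt
      calc _ = η * (1 + 4 * Real.sqrt 2 * DFIndex.alphaSup Ω * DFIndex.supNorm Ω) := by ring
        _ < 1 := hlt)
  refine DFIndex.isDFExponent_of_lt hopen hbdd hpsc hfr hne hη hη1 hK hKlt hRcl
    fun p hp τ hτ => ?_
  by_cases h0 : τ = 0
  · subst h0
    simp [DFIndex.alphaForm]
  have hτ0 : 0 < ‖τ‖ := norm_pos_iff.2 h0
  have h1 : ‖DFIndex.alpha Ω p τ‖ / DFIndex.vecNorm τ ≤ DFIndex.alphaSup Ω :=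
    le_csSup hba ⟨p, hp, τ, hτ, h0, rfl⟩
  rw [DFIndex.norm_alpha_div (hfr hp), div_le_iff₀ (by positivity)] at h1
  calc _ ≤ DFIndex.alphaSup Ω * (Real.sqrt 2 * ‖τ‖) := h1
    _ = _ := by ring
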